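/- Let $p\ge 3$ be prime and let $\mathfrak G$ be the $p$-adic Vilenkin group: sequences $x=(x_k)_{k\in\mathbb Z}$ over $\mathbb Z/p$ with $x_k=0$ for all sufficiently small $k$, added coordinatewise, topologized by the cosets of $\mathfrak G_n=\{x: x_k=0 \text{ for } k<n\}$, $n\in\mathbb Z$, with Haar measure $\mu$, $\mu(\mathfrak G_0)=1$. Let $(\mathcal A x)_k=x_{k+1}$ and $H_0=\{h\in\mathfrak G: h_k=0 \text{ for all } k\ge 0\}$. Let $X$ be the group of continuous unitary characters of $\mathfrak G$ (the value of $\chi$ at $x$ is written $(\chi,x)$), $\mathfrak G_n^\perp\subset X$ the annihilator of $\mathfrak G_n$, $(r_n,x)=e^{2\pi i x_n/p}$ the Rademacher functions, $(\chi\mathcal A^{-n},x)=(\chi,\mathcal A^{-n}x)$, and $\widehat f(\chi)=\int_{\mathfrak G} f(x)\overline{(\chi,x)}\,d\mu(x)$. Let $T$ be a tree with vertex set $\{0,1,\dots,p-1\}$, rooted at $0$. Let $\tilde E\subset\mathfrak G_1^\perp$ be the union of $\mathfrak G_{-1}^\perp$ and of the cosets $\mathfrak G_{-1}^\perp r_{-1}^{i}r_0^{j}$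 over all edges of $T$ with parent $j$ and child $i$. A function $m_0:X\to\mathbb C$ is a mask generated by $T$ if it is constant on the cosets of $\mathfrak G_{-1}^\perp$, $m_0=1$ on $\mathfrak G_{-1}^\perp$, $|m_0|=1$ on $\tilde E$, $m_0=0$ on $\mathfrak G_1^\perp\setminus\tilde E$, and $m_0(\chi r_1^{\alpha_1}\cdots r_s^{\alpha_s})=m_0(\chi)$ for all $\chi\in X$, $s\in\mathbb N$ and $\alpha_k\in\{0,\dots,p-1\}$. Then masks generated by $T$ exist, and for every such mask $m_0$ the following holds. There is a step function $\varphi$ on $\mathfrak G$ (supported in some $\mathfrak G_{-N}$ and constant on the cosets of some $\mathfrak G_M$) with $$\widehat\varphi(\chi)=\prod_{n=0}^\infty m_0(\chi\mathcal A^{-n})\quad\text{for all }\chi\in X,$$ and every $\varphi\in L_1(\mathfrak G)\cap L_2(\mathfrak G)$ with this Fourier transform generates an orthogonal multiresolution analysis of $L_2(\mathfrak G)$. That is, with $V_n$ the closed linear span in $L_2(\mathfrak G)$ of the functions $x\mapsto\varphi(\mathcal A^n x-h)$, $h\in H_0$ ($n\in\mathbb Z$): 1. $V_n\subset V_{n+1}$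 for all $n$; 2. $\overline{\bigcup_n V_n}=L_2(\mathfrak G)$ and $\bigcap_n V_n=\{0\}$; 3. $f\in V_n$ if and only if $f(\mathcal A\,\cdot)\in V_{n+1}$, for all $n$; 4. if $f\in V_0$, then $f(\cdot-h)\in V_0$ for all $h\in H_0$; 5. $(\varphi(\cdot-h))_{h\in H_0}$ is an orthonormal basis of $V_0$. -/

import Mathlib

open MeasureTheory Filter Topology
open scoped ComplexConjugate

/-- The `p`-adic Vilenkin group: two-sided sequences `x = (x_k)_{k ∈ ℤ}` of residues mod `p`
with only finitely many nonzero terms at negative indices (equivalently, `x_k = 0` for all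
sufficiently small `k`). -/
def Vilenkin (p : ℕ) : Type := {x : ℤ → ZMod p // ∃ m : ℤ, ∀ k < m, x k = 0}

namespace Vilenkin

variable {p : ℕ}

instance : CoeFun (Vilenkin p) (fun _ => ℤ → ZMod p) := ⟨Subtype.val⟩

@[ext] theorem ext {x y : Vilenkin p} (h : ∀ k, x k = y k) : x = y := Subtype.ext (funext h)

/-- The group of all sequences vanishing near `-∞`, with coordinatewise addition mod `p`. -/
def sequences (p : ℕ) : AddSubgroup (ℤ → ZMod p) where
  carrier := {x | ∃ m : ℤ, ∀ k < m, x k = 0}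
  zero_mem' := ⟨0, fun _ _ => rfl⟩
  add_mem' := by
    rintro x y ⟨m, hm⟩ ⟨n, hn⟩
    refine ⟨min m n, fun k hk => ?_⟩
    simp [hm k (lt_of_lt_of_le hk (min_le_left _ _)), hn k (lt_of_lt_of_le hk (min_le_right _ _))]
  neg_mem' := by
    rintro x ⟨m, hm⟩
    exact ⟨m, fun k hk => by simp [hm k hk]⟩

instance : AddCommGroup (Vilenkin p) := inferInstanceAs (AddCommGroup (sequences p))

@[simp] theorem zero_apply (k : ℤ) : (0 : Vilenkin p) k = 0 := rfl
@[simp] theorem add_apply (x y : Vilenkin p) (k : ℤ) : (x + y) k = x k + y k := rfl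
@[simp] theorem neg_apply (x : Vilenkin p) (k : ℤ) : (-x) k = -x k := rfl
@[simp] theorem sub_apply (x y : Vilenkin p) (k : ℤ) : (x - y) k = x k - y k := rfl

/-- The basic chain of subgroups `G_n = {x : x_k = 0 for k < n}`. -/
def chain (p : ℕ) (n : ℤ) : AddSubgroup (Vilenkin p) where
  carrier := {x | ∀ k < n, x k = 0}
  zero_mem' := fun _ _ => rfl
  add_mem' := by
    intro x y hx hy k hk
    simp [hx k hk, hy k hk]
  neg_mem' := by
    intro x hx k hk
    simp [hx k hk]

theorem mem_chain {n : ℤ} {x : Vilenkin p} : x ∈ chain p n ↔ ∀ k < n, x k = 0 := Iff.rfl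

/-- The topology generated by the cosets `G_n + g`. -/
instance : TopologicalSpace (Vilenkin p) :=
  TopologicalSpace.generateFrom {U | ∃ (n : ℤ) (g : Vilenkin p), U = {x | x - g ∈ chain p n}}

theorem isOpen_coset (n : ℤ) (g : Vilenkin p) : IsOpen {x : Vilenkin p | x - g ∈ chain p n} :=
  TopologicalSpace.isOpen_generateFrom_of_mem ⟨n, g, rfl⟩

instance : IsTopologicalAddGroup (Vilenkin p) where
  continuous_add := by
    refine continuous_generateFrom_iff.2 ?_
    rintro _ ⟨n, g, rfl⟩
    refine isOpen_iff_forall_mem_open.2 ?_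
    rintro ⟨x, y⟩ hxy
    refine ⟨{a | a - x ∈ chain p n} ×ˢ {b | b - y ∈ chain p n}, ?_,
      (isOpen_coset n x).prod (isOpen_coset n y), by simp⟩
    rintro ⟨a, b⟩ ⟨ha, hb⟩
    have h := (chain p n).add_mem ((chain p n).add_mem ha hb) hxy
    have e : a + b - g = a - x + (b - y) + (x + y - g) := by abel
    show a + b - g ∈ chain p n
    rw [e]
    exact h
  continuous_neg := by
    refine continuous_generateFrom_iff.2 ?_
    rintro _ ⟨n, g, rfl⟩
    convert isOpen_coset n (-g) using 1
    ext x
    show -x - g ∈ chain p n ↔ x - -g ∈ chain p n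
    rw [← neg_mem_iff (x := -x - g)]
    have e : -(-x - g) = x - -g := by abel
    rw [e]

instance : MeasurableSpace (Vilenkin p) := borel _
instance : BorelSpace (Vilenkin p) := ⟨rfl⟩

theorem isOpen_chain (n : ℤ) : IsOpen (chain p n : Set (Vilenkin p)) := by
  simpa using isOpen_coset (p := p) n 0

theorem isCompact_chain_zero [NeZero p] : IsCompact (chain p 0 : Set (Vilenkin p)) := by
  let _ : TopologicalSpace (ZMod p) := ⊥
  have : DiscreteTopology (ZMod p) := ⟨rfl⟩
  let f : (ℤ → ZMod p) → Vilenkin p := fun y =>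
    ⟨fun k => if k < 0 then 0 else y k, 0, fun k hk => if_pos hk⟩
  have hf : Continuous f := by
    refine continuous_generateFrom_iff.2 ?_
    rintro _ ⟨n, g, rfl⟩
    by_cases hg : ∃ k < n, k < 0 ∧ g k ≠ 0
    · obtain ⟨k, hk, hk0, hgk⟩ := hg
      convert isOpen_empty
      refine Set.eq_empty_iff_forall_notMem.2 fun y hy => hgk ?_
      have h : (if k < 0 then 0 else y k) - g k = 0 := hy k hk
      simpa [hk0] using h
    · push Not at hg
      have e : f ⁻¹' {x | x - g ∈ chain p n} =
          ⋂ k ∈ Finset.Ico (0 : ℤ) n, (fun y : ℤ → ZMod p => y k) ⁻¹' {g k} := by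
        ext y
        simp only [Set.mem_iInter, Finset.mem_Ico, Set.mem_preimage, Set.mem_singleton_iff]
        constructor
        · intro hy k hk
          have h : (if k < 0 then 0 else y k) - g k = 0 := hy k hk.2
          rw [if_neg (not_lt.2 hk.1)] at h
          exact sub_eq_zero.1 h
        · intro hy k hk
          show (if k < 0 then 0 else y k) - g k = 0
          split_ifs with h0
          · simp [hg k hk h0]
          · simp [hy k ⟨not_lt.1 h0, hk⟩]
      rw [e]
      exact isOpen_biInter_finset fun k _ => (isOpen_discrete _).preimage (continuous_apply k)
  convert isCompact_range hf
  ext x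
  constructor
  · intro hx
    refine ⟨x.1, Vilenkin.ext fun k => ?_⟩
    show (if k < 0 then 0 else x k) = x k
    split_ifs with h
    · exact (hx k h).symm
    · rfl
  · rintro ⟨y, rfl⟩ k hk
    exact if_pos hk

/-- The Haar measure `μ` on the Vilenkin group with `μ(G_0) = 1`. -/
noncomputable def haar (p : ℕ) [NeZero p] : Measure (Vilenkin p) :=
  Measure.addHaarMeasure
    ⟨⟨chain p 0, isCompact_chain_zero⟩,
      ⟨0, by simp [(isOpen_chain 0).interior_eq]⟩⟩

/-- `H_0`: the elements `a_{-1} g_{-1} + … + a_{-s} g_{-s}`, i.e. those with no nonzero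
coordinate at an index `≥ 0`. -/
def H₀ (p : ℕ) : Set (Vilenkin p) := {h | ∀ k ≥ (0 : ℤ), h k = 0}

/-- The dilation `A (∑ a_n g_n) = ∑ a_n g_{n-1}`, that is `(A x)_k = x_{k+1}`, as an
automorphism of the group. -/
def dilation (p : ℕ) : Vilenkin p ≃+ Vilenkin p where
  toFun x := ⟨fun k => x (k + 1), by
    obtain ⟨m, hm⟩ := x.2
    exact ⟨m - 1, fun k hk => hm _ (by lia)⟩⟩
  invFun x := ⟨fun k => x (k - 1), by
    obtain ⟨m, hm⟩ := x.2
    exact ⟨m, fun k hk => hm _ (by lia)⟩⟩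
  left_inv x := by ext k; show x (k - 1 + 1) = x k; simp
  right_inv x := by ext k; show x (k + 1 - 1) = x k; simp
  map_add' _ _ := rfl

theorem dilation_apply (x : Vilenkin p) (k : ℤ) : dilation p x k = x (k + 1) := rfl
theorem dilation_symm_apply (x : Vilenkin p) (k : ℤ) :
    (dilation p).symm x k = x (k - 1) := rfl

theorem continuous_dilation_symm : Continuous (dilation p).symm := by
  refine continuous_generateFrom_iff.2 ?_
  rintro _ ⟨n, g, rfl⟩
  convert isOpen_coset (n - 1) (dilation p g) using 1
  ext x
  constructor
  · intro h k hk
    have := h (k + 1) (by lia)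
    simpa [dilation_apply, dilation_symm_apply] using this
  · intro h k hk
    have := h (k - 1) (by lia)
    simpa [dilation_apply, dilation_symm_apply] using this

/-! ### Characters -/

/-- The group `X` of continuous unitary characters of the Vilenkin group, under pointwise
multiplication. -/
def dual (p : ℕ) : Subgroup (AddChar (Vilenkin p) Circle) where
  carrier := {χ | Continuous χ}
  one_mem' := continuous_const
  mul_mem' := fun {a b} ha hb => by
    show Continuous fun x => a x * b x
    exact Continuous.mul ha hb
  inv_mem' := fun {a} ha => by
    show Continuous fun x => a (-x)
    exact Continuous.comp ha continuous_neg

/-- The annihilator `G_n^⊥` of `G_n` in `X`. -/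
def annihilator (p : ℕ) (n : ℤ) : Subgroup (dual p) where
  carrier := {χ | ∀ x ∈ chain p n, χ.1 x = 1}
  one_mem' := fun _ _ => rfl
  mul_mem' := by
    intro a b ha hb x hx
    show a.1 x * b.1 x = 1
    rw [ha x hx, hb x hx, mul_one]
  inv_mem' := by
    intro a ha x hx
    exact ha (-x) ((chain p n).neg_mem hx)

/-- The Rademacher function `(r_n, x) = exp (2 π i x_n / p)`. -/
noncomputable def rademacher (p : ℕ) [NeZero p] (n : ℤ) : dual p :=
  ⟨{ toFun := fun x => ZMod.toCircle (x n)
     map_zero_eq_one' := by simp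
     map_add_eq_mul' := fun x y => by simp [AddChar.map_add_eq_mul] }, by
    refine continuous_def.2 fun s _ => isOpen_iff_forall_mem_open.2 fun x hx => ?_
    refine ⟨_, ?_, isOpen_coset (n + 1) x, by simp⟩
    intro y hy
    have h : y n - x n = 0 := hy n (by lia)
    have h' : y n = x n := sub_eq_zero.1 h
    show ZMod.toCircle (y n) ∈ s
    rw [h']
    exact hx⟩

/-- The power `A^n`, `n ∈ ℤ`, with respect to composition. -/
def dilationPow (p : ℕ) (n : ℤ) : Equiv.Perm (Vilenkin p) :=
  ((dilation p).toEquiv : Equiv.Perm (Vilenkin p)) ^ n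

/-- `χ ↦ χ A⁻¹`, where `(χ A⁻¹, x) = (χ, A⁻¹ x)`. -/
noncomputable def dualDilationInv (p : ℕ) (χ : dual p) : dual p :=
  ⟨{ toFun := fun x => χ.1 ((dilation p).symm x)
     map_zero_eq_one' := by simp
     map_add_eq_mul' := fun x y => by simp [AddChar.map_add_eq_mul] },
    Continuous.comp (g := χ.1) χ.2 continuous_dilation_symm⟩

/-- The Fourier transform `φ̂(χ) = ∫ φ(x) conj (χ, x) dμ(x)`. -/
noncomputable def fourier [NeZero p] (φ : Vilenkin p → ℂ) (χ : dual p) : ℂ :=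
  ∫ x, φ x * conj (χ.1 x : ℂ) ∂(haar p)

/-- Step functions: for some `M, N`, `φ` is supported in `G_{-N}` and constant on the cosets
of `G_M`. -/
def IsStepFunction (φ : Vilenkin p → ℂ) : Prop :=
  ∃ M N : ℕ, (∀ x, φ x ≠ 0 → x ∈ chain p (-(N : ℤ))) ∧
    ∀ x, ∀ y ∈ chain p (M : ℤ), φ (x + y) = φ x

/-! ### Trees, masks and refinable functions -/

/-- `j → i` is an edge of the tree `T` rooted at `0`, directed away from the root:
`j` is the parent of `i`. -/
def IsChild [NeZero p] (T : SimpleGraph (Fin p)) (j i : Fin p) : Prop :=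
  T.Adj j i ∧ T.dist 0 i = T.dist 0 j + 1

/-- The set `Ẽ ⊆ G_1^⊥` of a rooted tree: the union of `G_{-1}^⊥` and of the cosets
`G_{-1}^⊥ r_{-1}^i r_0^j`, where `(j, i)` runs over pairs of consecutive vertices on paths that
descend from the root. -/
def treeSet [NeZero p] (T : SimpleGraph (Fin p)) : Set (dual p) :=
  (annihilator p (-1) : Set (dual p)) ∪
    {χ | ∃ j i : Fin p, IsChild T j i ∧ ∃ ζ ∈ annihilator p (-1),
      χ = ζ * rademacher p (-1) ^ (i : ℕ) * rademacher p 0 ^ (j : ℕ)}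

/-- The rooted tree `T` generates the mask `m₀`. -/
structure GeneratesMask [NeZero p] (T : SimpleGraph (Fin p)) (m₀ : dual p → ℂ) : Prop where
  /-- `m₀` is constant on the cosets of `G_{-1}^⊥`. -/
  const_on_cosets : ∀ χ, ∀ ζ ∈ annihilator p (-1), m₀ (ζ * χ) = m₀ χ
  eq_one : ∀ ζ ∈ annihilator p (-1), m₀ ζ = 1
  norm_eq_one : ∀ χ ∈ treeSet T, ‖m₀ χ‖ = 1
  eq_zero : ∀ χ ∈ annihilator p 1, χ ∉ treeSet T → m₀ χ = 0
  /-- `m₀` is periodic with every period `r_1^{α_1} ⋯ r_s^{α_s}`. -/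
  periodic : ∀ (χ : dual p) (s : ℕ) (α : ℕ → Fin p),
    m₀ (χ * ∏ k ∈ Finset.Icc 1 s, rademacher p (k : ℤ) ^ (α k : ℕ)) = m₀ χ

/-- `φ ∈ L₂` (and integrable, so that the integral defining `φ̂(χ)` converges for each `χ`)
has Fourier transform `φ̂(χ) = ∏_{n ≥ 0} m₀(χ A^{-n})`. -/
structure HasMask [NeZero p] (m₀ : dual p → ℂ) (φ : Vilenkin p → ℂ) : Prop where
  integrable : Integrable φ (haar p)
  memLp : MemLp φ 2 (haar p)
  hasProd : ∀ χ, HasProd (fun n : ℕ => m₀ ((dualDilationInv p)^[n] χ)) (fourier φ χ)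

/-! ### Multiresolution analysis -/

/-- The space `L₂` of the Vilenkin group. -/
abbrev L₂ (p : ℕ) [NeZero p] : Type := Lp ℂ 2 (haar p)

/-- The class of the function `f` belongs to the subspace `V` of `L₂`. -/
def ClassMem [NeZero p] (f : Vilenkin p → ℂ) (V : Submodule ℂ (L₂ p)) : Prop :=
  ∃ g ∈ V, (g : Vilenkin p → ℂ) =ᵐ[haar p] f

/-- The shifts `φ(x - h)`, `h ∈ H_0`, form an orthonormal basis of the Hilbert space `V`. -/
def IsScalingFunction [NeZero p] (V : Submodule ℂ (L₂ p)) (φ : Vilenkin p → ℂ) : Prop :=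
  ∃ e : H₀ p → L₂ p, (∀ h, (e h : Vilenkin p → ℂ) =ᵐ[haar p] fun x => φ (x - h)) ∧
    Orthonormal ℂ e ∧ (Submodule.span ℂ (Set.range e)).topologicalClosure = V

/-- `(V_n)` is a multiresolution analysis of `L₂`. -/
structure IsMRA [NeZero p] (V : ℤ → Submodule ℂ (L₂ p)) : Prop where
  isClosed : ∀ n, IsClosed (V n : Set (L₂ p))
  mono : ∀ n, V n ≤ V (n + 1)
  closure_iUnion : closure (⋃ n, (V n : Set (L₂ p))) = Set.univ
  iInter : ⨅ n, V n = ⊥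
  dilation_mem_iff : ∀ n (f : Vilenkin p → ℂ),
    ClassMem f (V n) ↔ ClassMem (fun x => f (dilation p x)) (V (n + 1))
  shift_mem : ∀ f : Vilenkin p → ℂ, ClassMem f (V 0) →
    ∀ h ∈ H₀ p, ClassMem (fun x => f (x - h)) (V 0)
  exists_scaling : ∃ φ : Vilenkin p → ℂ, MemLp φ 2 (haar p) ∧ IsScalingFunction (V 0) φ

/-- `V_n`: the closed linear span in `L₂` of the functions `φ(A^n x - h)`, `h ∈ H_0`. -/
noncomputable def scaleSpace [NeZero p] (φ : Vilenkin p → ℂ) (n : ℤ) : Submodule ℂ (L₂ p) :=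
  (Submodule.span ℂ {g : L₂ p | ∃ h ∈ H₀ p,
    (g : Vilenkin p → ℂ) =ᵐ[haar p] fun x => φ (dilationPow p n x - h)}).topologicalClosure

/-- `φ` generates an orthogonal MRA: its `H_0`-shifts are an orthonormal system (a basis of
`V_0`), and the spaces `V_n` form a multiresolution analysis. -/
def GeneratesMRA [NeZero p] (φ : Vilenkin p → ℂ) : Prop :=
  MemLp φ 2 (haar p) ∧ IsScalingFunction (scaleSpace φ 0) φ ∧ IsMRA (scaleSpace φ)

end Vilenkin

/-!
# Orthogonal multiresolution analyses on Vilenkin groups generated by trees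

A character `χ` of the Vilenkin group has coordinates `coef χ k ∈ ℤ/p`, `k ∈ ℤ`, which vanish for
large `k`; the subgroup `G_n^⊥` is given by the vanishing of the coordinates at `k ≥ n`, and
`χ ↦ χ A⁻¹` shifts the coordinates. In these terms a mask generated by the tree `T` depends on the
coordinates `(α, β)` at `(-1, 0)` only, is unimodular if `β` is the parent of `α` and zero otherwise
(`GeneratesMask.exists_eq`; the root `0` counts as its own parent). Hence the infinite product is
nonzero at `χ` exactly if the coordinates `coef χ (-1), coef χ 0, coef χ 1, …` are the successive
ancestors of `a = coef χ (-1)`, that is, if `χ` lies in `G_{-1}^⊥ χ_a` for the character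
`χ_a = pathChar a`. For each `a` there is one such coset, and only finitely many factors differ
from `1` on it. So the product is the Fourier transform of the explicit step function
`φ = p⁻¹ 1_{G_{-1}} ∑_a c_a χ_a`, with `|c_a| = 1` (`hasProd_fourier_scalingFun`), and every
integrable function with this Fourier transform equals `φ` almost everywhere
(`ae_eq_zero_of_fourier_eq_zero`).

The shifts of `φ` are orthonormal by the orthogonality of the characters of `ℤ/p`
(`integral_scalingFun_shift`). A discrete Fourier transform over the shifts by multiples of `g_{-1}`
shows that `V_n` is the closed span of the functions `(1_{G_{-1}+h} χ_a)(A^n x)`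
(`scaleSpace_scalingFun`), and the remaining properties can be read off from these:
* `χ_a` is, on each coset of `G_0`, a constant multiple of `χ_{parent a} ∘ A`, so `V_n ⊆ V_{n+1}`;
* for `a = 0` they are the indicators of the cosets of `G_{n-1}`, so the union is dense;
* they are constant on the cosets of `G_{n+D-1}` for a fixed `D`, so the integral of a function in
  all the `V_n` over a coset is arbitrarily small, and the intersection is zero.
-/

open MeasureTheory Filter Topology
open scoped ComplexConjugate

namespace Vilenkin

open scoped ENNReal

variable {p : ℕ}

/-! ### Cosets of the basic subgroups, topology and measure -/

/-- The coset `G_n + g`, that is, the set of all `x` with `x_k = g_k` for `k < n`. -/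
def coset (n : ℤ) (g : Vilenkin p) : Set (Vilenkin p) := {x | x - g ∈ chain p n}

theorem mem_coset {n : ℤ} {g x : Vilenkin p} : x ∈ coset n g ↔ ∀ k < n, x k = g k := by
  simp only [coset, Set.mem_ofPred_eq, mem_chain, sub_apply, sub_eq_zero]

theorem coset_zero (n : ℤ) : coset n (0 : Vilenkin p) = chain p n := by
  ext x; simp [coset]

/-- The sequence with entry `t` at the index `k` and zeros elsewhere. -/
def single (k : ℤ) (t : ZMod p) : Vilenkin p :=
  ⟨fun j => if j = k then t else 0, k, fun _ hj => if_neg hj.ne⟩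

theorem single_apply (k j : ℤ) (t : ZMod p) : single k t j = if j = k then t else 0 :=
  rfl

theorem single_add (k : ℤ) (s t : ZMod p) : single k (s + t) = single k s + single k t := by
  ext j; simp only [single_apply, add_apply]; split_ifs <;> simp

@[simp] theorem single_zero (k : ℤ) : single k (0 : ZMod p) = 0 := by
  ext j; simp [single_apply]

theorem sum_apply {ι : Type*} (s : Finset ι) (f : ι → Vilenkin p) (k : ℤ) :
    (∑ i ∈ s, f i) k = ∑ i ∈ s, f i k := by
  classical
  induction s using Finset.induction_on with
  | empty => rfl
  | insert a s ha ih => rw [Finset.sum_insert ha, Finset.sum_insert ha, add_apply, ih]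

theorem measurableSet_coset (n : ℤ) (g : Vilenkin p) : MeasurableSet (coset n g) :=
  (isOpen_coset n g).measurableSet

theorem coset_eq_of_mem {n : ℤ} {g x : Vilenkin p} (h : x ∈ coset n g) :
    coset n g = coset n x := by
  ext y
  rw [mem_coset] at h
  simp only [mem_coset]
  exact forall₂_congr fun k hk => by rw [h k hk]

theorem coset_subset {m n : ℤ} (h : m ≤ n) (g : Vilenkin p) : coset n g ⊆ coset m g :=
  fun _ hx => mem_coset.2 fun k hk => mem_coset.1 hx k (hk.trans_le h)

theorem mem_coset_self (n : ℤ) (g : Vilenkin p) : g ∈ coset n g := mem_coset.2 fun _ _ => rfl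

theorem isPiSystem_coset :
    IsPiSystem (Set.range fun q : ℤ × Vilenkin p => coset q.1 q.2) := by
  rintro _ ⟨⟨n, g⟩, rfl⟩ _ ⟨⟨m, h⟩, rfl⟩ ⟨z, hz, hz'⟩
  refine ⟨⟨max n m, z⟩, ?_⟩
  dsimp only at *
  rw [coset_eq_of_mem hz, coset_eq_of_mem hz']
  ext x
  simp only [Set.mem_inter_iff, mem_coset, lt_max_iff]
  exact ⟨fun H => ⟨fun k hk => H k (.inl hk), fun k hk => H k (.inr hk)⟩,
    fun H k hk => hk.elim (H.1 k) (H.2 k)⟩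

/-- The cosets of the basic subgroups form a countable family: a coset of `G_n` is determined by
the finitely many nonzero coordinates of its members below the index `n`. -/
theorem countable_cosets [NeZero p] :
    {U : Set (Vilenkin p) | ∃ (n : ℤ) (g : Vilenkin p), U = {x | x - g ∈ chain p n}}.Countable := by
  have hc : (Set.range fun q : ℤ × (ℤ →₀ ZMod p) =>
      {x : Vilenkin p | ∀ k < q.1, x k = q.2 k}).Countable := Set.countable_range _
  refine hc.mono ?_
  rintro _ ⟨n, g, rfl⟩
  obtain ⟨m, hm⟩ := g.2
  let f : ℤ →₀ ZMod p := Finsupp.onFinset (Finset.Ico m n)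
    (fun k => if k ∈ Finset.Ico m n then g k else 0) (by
      intro k hk
      by_contra h
      simp [h] at hk)
  refine ⟨⟨n, f⟩, ?_⟩
  ext x
  change (∀ k < n, x k = f k) ↔ x ∈ coset n g
  rw [mem_coset]
  refine forall₂_congr fun k hk => ?_
  have : f k = g k := by
    simp only [f, Finsupp.onFinset_apply, Finset.mem_Ico]
    split_ifs with h
    · rfl
    · exact (hm k (by lia)).symm
  rw [this]

instance [NeZero p] : SecondCountableTopology (Vilenkin p) :=
  ⟨_, countable_cosets, rfl⟩

instance [NeZero p] : LocallyCompactSpace (Vilenkin p) :=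
  isCompact_chain_zero.locallyCompactSpace_of_mem_nhds_of_addGroup
    ((isOpen_chain 0).mem_nhds (zero_mem (chain p 0)))

theorem measurableSpace_eq_generateFrom [NeZero p] :
    (inferInstance : MeasurableSpace (Vilenkin p)) =
      MeasurableSpace.generateFrom (Set.range fun q : ℤ × Vilenkin p => coset q.1 q.2) := by
  refine borel_eq_generateFrom_of_subbasis ?_
  change TopologicalSpace.generateFrom _ = TopologicalSpace.generateFrom _
  congr 1
  ext U
  simp only [Set.mem_ofPred_eq, Set.mem_range, Prod.exists, coset, eq_comm]

instance [NeZero p] : (haar p).IsAddHaarMeasure := by unfold haar; infer_instance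

theorem haar_chain_zero [NeZero p] : haar p (chain p 0) = 1 := Measure.addHaarMeasure_self

theorem haar_coset [NeZero p] (n : ℤ) (g : Vilenkin p) :
    haar p (coset n g) = haar p (chain p n) := by
  have : coset n g = (fun x => x + (-g)) ⁻¹' (chain p n : Set (Vilenkin p)) := by
    ext x; simp [coset, sub_eq_add_neg]
  rw [this, measure_preimage_add_right]

/-- A coset of `G_n` is the disjoint union of `p` cosets of `G_{n+1}`. -/
theorem coset_eq_iUnion (n : ℤ) (g : Vilenkin p) :
    coset n g = ⋃ t : ZMod p, coset (n + 1) (g + single n t) := by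
  ext x
  simp only [Set.mem_iUnion, mem_coset, add_apply, single_apply]
  constructor
  · intro h
    refine ⟨x n - g n, fun k hk => ?_⟩
    split_ifs with hkn
    · subst hkn; simp
    · simpa using h k (by lia)
  · rintro ⟨t, h⟩ k hk
    simpa [hk.ne] using h k (by lia)

theorem pairwise_disjoint_coset (n : ℤ) (g : Vilenkin p) :
    Pairwise (Function.onFun Disjoint fun t : ZMod p => coset (n + 1) (g + single n t)) := by
  intro s t hst
  refine Set.disjoint_left.2 fun x hs ht => hst ?_
  have h1 := mem_coset.1 hs n (by lia)
  have h2 := mem_coset.1 ht n (by lia)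
  simp only [add_apply, single_apply, if_true] at h1 h2
  exact add_left_cancel (h1.symm.trans h2)

theorem haar_chain_succ [NeZero p] (n : ℤ) :
    haar p (chain p n) = p * haar p (chain p (n + 1)) := by
  rw [← haar_coset n 0, coset_eq_iUnion,
    measure_iUnion (pairwise_disjoint_coset n 0) fun t => measurableSet_coset _ _]
  simp [haar_coset, tsum_fintype, ZMod.card]

theorem haar_chain [NeZero p] (n : ℤ) : haar p (chain p n) = (p : ℝ≥0∞) ^ (-n) := by
  have hp : (p : ℝ≥0∞) ≠ 0 := by simp [NeZero.ne p]
  have hp' : (p : ℝ≥0∞) ≠ ∞ := ENNReal.natCast_ne_top p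
  have key (n : ℤ) : haar p (chain p n) = p ^ (-n) ↔
      haar p (chain p (n + 1)) = p ^ (-(n + 1)) := by
    rw [haar_chain_succ n, show (-n : ℤ) = 1 + -(n + 1) by ring, ENNReal.zpow_add hp hp',
      zpow_one]
    exact ENNReal.mul_right_inj hp hp'
  induction n with
  | zero => simpa using haar_chain_zero
  | succ n ih => exact (key _).1 ih
  | pred n ih => exact (key _).2 (by simpa using ih)

theorem haar_coset_ne_top [NeZero p] (n : ℤ) (g : Vilenkin p) : haar p (coset n g) ≠ ∞ := by
  rw [haar_coset, haar_chain]
  exact ENNReal.zpow_ne_top (by simp [NeZero.ne p]) (by simp) _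

theorem haar_real_coset [NeZero p] (n : ℤ) (g : Vilenkin p) :
    (haar p).real (coset n g) = (p : ℝ) ^ (-n) := by
  rw [measureReal_def, haar_coset, haar_chain]
  generalize -n = m
  cases m <;> simp [zpow_negSucc]

theorem iUnion_chain : ⋃ N : ℕ, coset (-(N : ℤ)) (0 : Vilenkin p) = Set.univ := by
  refine Set.eq_univ_of_forall fun x => Set.mem_iUnion.2 ?_
  obtain ⟨m, hm⟩ := x.2
  exact ⟨(-m).toNat, mem_coset.2 fun k hk => hm k (by lia)⟩

theorem measure_ext_coset [NeZero p] {μ ν : Measure (Vilenkin p)}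
    (hμ : ∀ n g, μ (coset n g) ≠ ∞) (h : ∀ n g, μ (coset n g) = ν (coset n g)) : μ = ν := by
  refine Measure.ext_of_generateFrom_of_iUnion _ _ measurableSpace_eq_generateFrom
    isPiSystem_coset iUnion_chain (fun i => ⟨⟨_, _⟩, rfl⟩) (fun i => hμ _ _) ?_
  rintro _ ⟨⟨n, g⟩, rfl⟩
  exact h n g

/-- A function, integrable on each `G_{-N}`, all of whose integrals over cosets vanish is zero
almost everywhere. -/
theorem ae_eq_zero_of_forall_setIntegral_coset [NeZero p] {f : Vilenkin p → ℂ}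
    (hf : ∀ n g, IntegrableOn f (coset n g) (haar p))
    (h : ∀ n g, ∫ x in coset n g, f x ∂(haar p) = 0) : f =ᵐ[haar p] 0 := by
  have key (N : ℕ) : f =ᵐ[(haar p).restrict (coset (-(N : ℤ)) 0)] 0 := by
    refine Integrable.ae_eq_zero_of_forall_setIntegral_eq_zero (hf _ _) fun s hs _ => ?_
    set ν := (haar p).restrict (coset (-(N : ℤ)) 0) with hν
    have hi : Integrable f ν := hf _ _
    refine MeasurableSpace.induction_on_inter
      (C := fun s _ => ∫ x in s, f x ∂ν = 0)
      measurableSpace_eq_generateFrom isPiSystem_coset ?_ ?_ ?_ ?_ s hs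
    · simp
    · rintro _ ⟨⟨n, g⟩, rfl⟩
      dsimp only
      rw [hν, Measure.restrict_restrict (measurableSet_coset _ _)]
      rcases (coset n g ∩ coset (-(N : ℤ)) 0).eq_empty_or_nonempty with he | hne
      · simp [he]
      · obtain ⟨⟨m, z⟩, hz⟩ := isPiSystem_coset _ ⟨⟨n, g⟩, rfl⟩ _ ⟨⟨-(N : ℤ), 0⟩, rfl⟩ hne
        dsimp only at hz
        rw [← hz, h]
    · intro t ht h0
      have := integral_add_compl ht hi
      rw [h0, zero_add] at this
      rw [this]
      exact h _ _
    · intro F hd hm h0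
      rw [integral_iUnion hm hd hi.integrableOn]
      simp [h0]
  have := (ae_restrict_iUnion_iff (μ := haar p)
    (fun N : ℕ => coset (-(N : ℤ)) (0 : Vilenkin p)) (fun x => f x = (0 : Vilenkin p → ℂ) x)).2 key
  rwa [iUnion_chain, Measure.restrict_univ] at this

/-! ### The dilation -/

theorem dilation_preimage_coset (n : ℤ) (g : Vilenkin p) :
    dilation p ⁻¹' coset n g = coset (n + 1) ((dilation p).symm g) := by
  ext x
  simp only [Set.mem_preimage, mem_coset, dilation_apply, dilation_symm_apply]
  exact ⟨fun h k hk => by simpa using h (k - 1) (by lia),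
    fun h k hk => by simpa using h (k + 1) (by lia)⟩

theorem continuous_dilation : Continuous (dilation p) := by
  refine continuous_generateFrom_iff.2 ?_
  rintro _ ⟨n, g, rfl⟩
  change IsOpen (dilation p ⁻¹' coset n g)
  rw [dilation_preimage_coset]
  exact isOpen_coset _ _

theorem map_dilation_haar [NeZero p] :
    (haar p).map (dilation p) = (p : ℝ≥0∞)⁻¹ • haar p := by
  have e (n : ℤ) (g : Vilenkin p) :
      (haar p).map (dilation p) (coset n g) = haar p (coset (n + 1) ((dilation p).symm g)) := by
    rw [Measure.map_apply continuous_dilation.measurable (measurableSet_coset _ _),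
      dilation_preimage_coset]
  refine measure_ext_coset (fun n g => ?_) fun n g => ?_
  · rw [e]; exact haar_coset_ne_top _ _
  · rw [e, haar_coset, Measure.smul_apply, haar_coset, haar_chain_succ n, smul_eq_mul, ← mul_assoc,
      ENNReal.inv_mul_cancel (by simp [NeZero.ne p]) (by simp), one_mul]

theorem map_dilation_symm_haar [NeZero p] :
    (haar p).map (dilation p).symm = (p : ℝ≥0∞) • haar p := by
  have h := congrArg (Measure.map (dilation p).symm) (map_dilation_haar (p := p))
  rw [Measure.map_map continuous_dilation_symm.measurable continuous_dilation.measurable,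
    Measure.map_smul, show ⇑(dilation p).symm ∘ ⇑(dilation p) = id by ext1 x; simp,
    Measure.map_id] at h
  nth_rw 2 [h]
  rw [smul_smul, ENNReal.mul_inv_cancel (by simp [NeZero.ne p]) (by simp), one_smul]

theorem dilationPow_apply (n k : ℤ) (x : Vilenkin p) : dilationPow p n x k = x (k + n) := by
  have hs (m : ℤ) (y : Vilenkin p) : dilationPow p (m + 1) y = dilationPow p m (dilation p y) := by
    unfold dilationPow
    rw [zpow_add_one, Equiv.Perm.mul_apply]
    rfl
  induction n generalizing x with
  | zero => simp [dilationPow]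
  | succ n ih => rw [hs, ih, dilation_apply, add_assoc]
  | pred n ih =>
    have := hs (-(n : ℤ) - 1) ((dilation p).symm x)
    rw [sub_add_cancel, AddEquiv.apply_symm_apply] at this
    rw [← this, ih, dilation_symm_apply, show k + -(n : ℤ) - 1 = k + (-(n : ℤ) - 1) by ring]

theorem dilationPow_add_one (n : ℤ) (x : Vilenkin p) :
    dilationPow p (n + 1) x = dilationPow p n (dilation p x) := by
  ext k; rw [dilationPow_apply, dilationPow_apply, dilation_apply, add_assoc]

theorem dilationPow_zero (x : Vilenkin p) : dilationPow p 0 x = x := by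
  ext k; simp [dilationPow_apply]

theorem dilationPow_mem_coset {n m : ℤ} {x g : Vilenkin p} :
    dilationPow p n x ∈ coset m (dilationPow p n g) ↔ x ∈ coset (m + n) g := by
  simp only [mem_coset, dilationPow_apply]
  exact ⟨fun h k hk => by simpa using h (k - n) (by lia), fun h k hk => h _ (by lia)⟩

theorem quasiMeasurePreserving_dilation [NeZero p] :
    Measure.QuasiMeasurePreserving (dilation p) (haar p) (haar p) :=
  ⟨continuous_dilation.measurable, by
    rw [map_dilation_haar]
    exact Measure.smul_absolutelyContinuous⟩

theorem quasiMeasurePreserving_dilation_symm [NeZero p] :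
    Measure.QuasiMeasurePreserving (dilation p).symm (haar p) (haar p) :=
  ⟨continuous_dilation_symm.measurable, by
    rw [map_dilation_symm_haar]
    exact Measure.smul_absolutelyContinuous⟩

theorem quasiMeasurePreserving_dilationPow [NeZero p] (n : ℤ) :
    Measure.QuasiMeasurePreserving (dilationPow p n) (haar p) (haar p) := by
  induction n with
  | zero =>
    rw [show ⇑(dilationPow p 0) = id from funext dilationPow_zero]
    exact Measure.QuasiMeasurePreserving.id _
  | succ n ih =>
    rw [show ⇑(dilationPow p ((n : ℤ) + 1)) = dilationPow p n ∘ dilation p from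
      funext (dilationPow_add_one _)]
    exact ih.comp quasiMeasurePreserving_dilation
  | pred n ih =>
    rw [show ⇑(dilationPow p (-(n : ℤ) - 1)) = dilationPow p (-(n : ℤ)) ∘ (dilation p).symm from
      funext fun x => by
        have := dilationPow_add_one (-(n : ℤ) - 1) ((dilation p).symm x)
        rw [sub_add_cancel, AddEquiv.apply_symm_apply] at this
        exact this.symm]
    exact ih.comp quasiMeasurePreserving_dilation_symm

section NeZero

variable [NeZero p]

/-! ### Coordinates on the dual group -/

omit [NeZero p] in
theorem dual_map_add (χ : dual p) (x y : Vilenkin p) : χ.1 (x + y) = χ.1 x * χ.1 y :=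
  AddChar.map_add_eq_mul _ _ _

omit [NeZero p] in
theorem dual_map_sum (χ : dual p) {ι : Type*} (s : Finset ι) (f : ι → Vilenkin p) :
    χ.1 (∑ i ∈ s, f i) = ∏ i ∈ s, χ.1 (f i) := by
  classical
  induction s using Finset.induction_on with
  | empty => exact χ.1.map_zero_eq_one
  | insert a s ha ih => rw [Finset.sum_insert ha, Finset.prod_insert ha, dual_map_add, ih]

/-- The restriction of a character to the copy of `ℤ/p` at the index `k`. -/
noncomputable def restrictSingle (χ : dual p) (k : ℤ) : AddChar (ZMod p) Circle where
  toFun t := χ.1 (single k t)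
  map_zero_eq_one' := by simp
  map_add_eq_mul' s t := by rw [single_add, dual_map_add]

/-- The `k`-th coordinate of a character `χ`: the residue `α` with
`(χ, t g_k) = exp (2 π i α t / p)`. -/
noncomputable def coef (χ : dual p) (k : ℤ) : ZMod p :=
  AddChar.zmodAddEquiv.symm (AddChar.circleEquivComplex (restrictSingle χ k))

theorem apply_single (χ : dual p) (k : ℤ) (t : ZMod p) :
    χ.1 (single k t) = ZMod.toCircle (coef χ k * t) := by
  have h : AddChar.zmod p (coef χ k) = restrictSingle χ k := by
    apply AddChar.circleEquivComplex.injective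
    rw [← AddChar.zmodAddEquiv_apply]
    exact AddEquiv.apply_symm_apply _ _
  exact (DFunLike.congr_fun h t).symm

theorem coef_eq_of_forall {χ : dual p} {k : ℤ} {a : ZMod p}
    (h : ∀ t, χ.1 (single k t) = ZMod.toCircle (a * t)) : coef χ k = a := by
  have := h 1
  rw [apply_single, mul_one, mul_one] at this
  exact ZMod.injective_toCircle this

@[simp] theorem coef_one (k : ℤ) : coef (1 : dual p) k = 0 :=
  coef_eq_of_forall fun t => by simp

@[simp] theorem coef_mul (χ ψ : dual p) (k : ℤ) : coef (χ * ψ) k = coef χ k + coef ψ k :=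
  coef_eq_of_forall fun t => by
    rw [add_mul, AddChar.map_add_eq_mul, ← apply_single, ← apply_single]
    rfl

@[simp] theorem coef_inv (χ : dual p) (k : ℤ) : coef χ⁻¹ k = -coef χ k := by
  have := coef_mul χ χ⁻¹ k
  rw [mul_inv_cancel, coef_one] at this
  exact (neg_eq_of_add_eq_zero_right this.symm).symm

@[simp] theorem coef_pow (χ : dual p) (n : ℕ) (k : ℤ) : coef (χ ^ n) k = n * coef χ k := by
  induction n with
  | zero => simp
  | succ n ih => rw [pow_succ, coef_mul, ih]; push_cast; ring

@[simp] theorem coef_prod {ι : Type*} (s : Finset ι) (f : ι → dual p) (k : ℤ) :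
    coef (∏ i ∈ s, f i) k = ∑ i ∈ s, coef (f i) k := by
  classical
  induction s using Finset.induction_on with
  | empty => simp
  | insert a s ha ih => rw [Finset.prod_insert ha, Finset.sum_insert ha, coef_mul, ih]

theorem rademacher_apply (n : ℤ) (x : Vilenkin p) :
    (rademacher p n).1 x = ZMod.toCircle (x n) := rfl

theorem rademacher_pow_apply (n : ℤ) (m : ℕ) (x : Vilenkin p) :
    (rademacher p n ^ m).1 x = ZMod.toCircle ((m : ZMod p) * x n) := by
  rw [← nsmul_eq_mul, AddChar.map_nsmul_eq_pow]
  rfl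

theorem coef_rademacher (n k : ℤ) : coef (rademacher p n) k = if k = n then 1 else 0 :=
  coef_eq_of_forall fun t => by
    rw [rademacher_apply, single_apply]
    congr 1
    by_cases h : k = n
    · simp [h]
    · have h' : n ≠ k := fun e => h e.symm
      simp [h, h']

theorem coef_dualDilationInv (χ : dual p) (k : ℤ) :
    coef (dualDilationInv p χ) k = coef χ (k + 1) :=
  coef_eq_of_forall fun t => by
    rw [← apply_single]
    change χ.1 ((dilation p).symm (single k t)) = _
    congr 1
    ext j
    simp [dilation_symm_apply, single_apply, sub_eq_iff_eq_add]

theorem coef_iterate_dualDilationInv (χ : dual p) (n : ℕ) (k : ℤ) :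
    coef ((dualDilationInv p)^[n] χ) k = coef χ (k + n) := by
  induction n generalizing k with
  | zero => simp
  | succ n ih =>
    rw [Function.iterate_succ_apply', coef_dualDilationInv, ih]
    push_cast
    ring_nf

omit [NeZero p] in
theorem exists_coset_subset {U : Set (Vilenkin p)} (hU : IsOpen U) {x : Vilenkin p} (hx : x ∈ U) :
    ∃ n : ℕ, coset n x ⊆ U := by
  induction hU with
  | basic s hs =>
    obtain ⟨n, g, rfl⟩ := hs
    change x ∈ coset n g at hx
    refine ⟨n.toNat, (coset_subset (m := n) (by lia) x).trans ?_⟩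
    exact (coset_eq_of_mem hx).symm.subset
  | univ => exact ⟨0, Set.subset_univ _⟩
  | inter s t _ _ ihs iht =>
    obtain ⟨n, hn⟩ := ihs hx.1
    obtain ⟨m, hm⟩ := iht hx.2
    exact ⟨max n m, Set.subset_inter ((coset_subset (by simp) x).trans hn)
      ((coset_subset (by simp) x).trans hm)⟩
  | sUnion S _ ih =>
    obtain ⟨s, hs, hxs⟩ := hx
    obtain ⟨n, hn⟩ := ih s hs hxs
    exact ⟨n, hn.trans (Set.subset_sUnion_of_mem hs)⟩

omit [NeZero p] in
theorem nsmul_eq_zero (x : Vilenkin p) : p • x = 0 := by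
  have h (n : ℕ) (k : ℤ) : (n • x) k = n * x k := by
    induction n with
    | zero => simp
    | succ n ih => rw [succ_nsmul, add_apply, ih]; push_cast; ring
  ext k
  simp [h]

/-- The values of a character are `p`-th roots of unity. -/
theorem exists_toCircle_eq (χ : dual p) (x : Vilenkin p) : ∃ t : ZMod p, ZMod.toCircle t = χ.1 x := by
  have h : χ.1 x ^ p = 1 := by
    rw [← AddChar.map_nsmul_eq_pow, nsmul_eq_zero, AddChar.map_zero_eq_one]
  obtain ⟨t, ht⟩ := (bijective_rootsOfUnityAddChar p).2
    ⟨toUnits (χ.1 x), by ext1; simpa using h⟩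
  exact ⟨t, by simpa [Subtype.ext_iff, Units.ext_iff] using congrArg (fun z => (z.1 : Circle)) ht⟩

/-- Every continuous character is trivial on some `G_M`, since it takes finitely many values. -/
theorem exists_mem_annihilator (χ : dual p) : ∃ M : ℕ, χ ∈ annihilator p M := by
  let F : Set Circle := ZMod.toCircle '' {t : ZMod p | t ≠ 0}
  have hF : IsOpen Fᶜ := (Set.toFinite F).isClosed.isOpen_compl
  have h0 : (0 : Vilenkin p) ∈ χ.1 ⁻¹' Fᶜ := by
    rintro ⟨t, ht, h⟩
    rw [AddChar.map_zero_eq_one, ← AddChar.map_zero_eq_one (ZMod.toCircle (N := p))] at h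
    exact ht (ZMod.injective_toCircle h)
  obtain ⟨M, hM⟩ := exists_coset_subset (hF.preimage χ.2) h0
  refine ⟨M, fun x hx => ?_⟩
  obtain ⟨t, ht⟩ := exists_toCircle_eq χ x
  by_cases h : t = 0
  · rw [← ht, h, AddChar.map_zero_eq_one]
  · rw [coset_zero] at hM
    exact absurd ⟨t, h, ht⟩ (hM hx)

omit [NeZero p] in
theorem sub_sum_single_mem_chain {x : Vilenkin p} {n : ℤ} (hx : x ∈ chain p n) (m : ℤ) :
    x - ∑ k ∈ Finset.Ico n m, single k (x k) ∈ chain p m := by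
  intro j hj
  rw [sub_apply, sum_apply, sub_eq_zero]
  simp only [single_apply]
  rw [Finset.sum_ite_eq]
  split_ifs with h
  · rfl
  · exact hx j (by simp at h; lia)

theorem mem_annihilator_iff {χ : dual p} {n : ℤ} :
    χ ∈ annihilator p n ↔ ∀ k ≥ n, coef χ k = 0 := by
  constructor
  · intro h k hk
    refine coef_eq_of_forall fun t => ?_
    rw [h, zero_mul, AddChar.map_zero_eq_one]
    intro j hj
    rw [single_apply, if_neg (by lia)]
  · intro h x hx
    obtain ⟨M, hM⟩ := exists_mem_annihilator χ
    have h1 := hM _ (sub_sum_single_mem_chain hx M)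
    have h2 : χ.1 (∑ k ∈ Finset.Ico n M, single k (x k)) = 1 := by
      rw [dual_map_sum]
      refine Finset.prod_eq_one fun k hk => ?_
      rw [apply_single, h k (Finset.mem_Ico.1 hk).1, zero_mul, AddChar.map_zero_eq_one]
    rw [← sub_add_cancel x (∑ k ∈ Finset.Ico n M, single k (x k)), dual_map_add, h1, h2, one_mul]

/-! ### Integrals of characters and uniqueness for the Fourier transform -/

omit [NeZero p] in
theorem continuous_dual (χ : dual p) : Continuous fun x => (χ.1 x : ℂ) :=
  continuous_subtype_val.comp χ.2

open Classical in
/-- Orthogonality of characters on a coset. -/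
theorem setIntegral_coset_dual (χ : dual p) (n : ℤ) (g : Vilenkin p) :
    ∫ x in coset n g, (χ.1 x : ℂ) ∂(haar p) =
      if χ ∈ annihilator p n then (p : ℂ) ^ (-n) * χ.1 g else 0 := by
  split_ifs with h
  · have e : ∀ x ∈ coset n g, (χ.1 x : ℂ) = χ.1 g := fun x hx => by
      rw [← sub_add_cancel x g, dual_map_add, h _ hx, one_mul]
    rw [setIntegral_congr_fun (measurableSet_coset n g) e, setIntegral_const, haar_real_coset,
      Complex.real_smul]
    push_cast
    rfl
  · obtain ⟨y, hy, hχ⟩ : ∃ y ∈ chain p n, χ.1 y ≠ 1 := by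
      by_contra! H
      exact h H
    rw [← integral_indicator (measurableSet_coset n g)]
    set F := (coset n g).indicator fun x => (χ.1 x : ℂ)
    have e (x : Vilenkin p) : F (x + y) = χ.1 y * F x := by
      have hm : x + y ∈ coset n g ↔ x ∈ coset n g := by
        simp only [mem_coset, add_apply]
        exact forall₂_congr fun k hk => by rw [hy k hk, add_zero]
      simp only [F, Set.indicator_apply, hm, dual_map_add]
      split_ifs <;> simp [mul_comm]
    have h1 : ∫ x, F (x + y) ∂(haar p) = ∫ x, F x ∂(haar p) := integral_add_right_eq_self F y
    simp only [e] at h1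
    rw [integral_const_mul] at h1
    by_contra h0
    exact hχ (Circle.ext (mul_right_cancel₀ h0 (h1.trans (one_mul _).symm)))

theorem sum_stdAddChar_mul (d : ZMod p) :
    ∑ t : ZMod p, ZMod.stdAddChar (t * d) = if d = 0 then (p : ℂ) else 0 := by
  rw [AddChar.sum_mulShift d (ZMod.isPrimitive_stdAddChar p)]
  split_ifs <;> simp [ZMod.card]

theorem fourier_mul_dual (f : Vilenkin p → ℂ) (χ ψ : dual p) :
    fourier (fun x => f x * ψ.1 x) χ = fourier f (χ * ψ⁻¹) := by
  unfold fourier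
  congr 1
  ext x
  have : ((χ * ψ⁻¹).1 x : ℂ) = χ.1 x * conj (ψ.1 x : ℂ) := by
    change ((χ.1 x * ψ.1 (-x) : Circle) : ℂ) = _
    rw [AddChar.map_neg_eq_inv, Circle.coe_mul, Circle.coe_inv_eq_conj]
  rw [this, map_mul, Complex.conj_conj]
  ring

theorem integrable_mul_dual {f : Vilenkin p → ℂ} (hf : Integrable f (haar p)) (χ : dual p) :
    Integrable (fun x => f x * χ.1 x) (haar p) :=
  hf.mul_bdd (c := 1) (continuous_dual χ).aestronglyMeasurable
    (.of_forall fun _ => (Circle.norm_coe _).le)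

theorem integrable_mul_conj_dual {f : Vilenkin p → ℂ} (hf : Integrable f (haar p)) (χ : dual p) :
    Integrable (fun x => f x * conj (χ.1 x : ℂ)) (haar p) :=
  hf.mul_bdd (c := 1) (Complex.continuous_conj.comp (continuous_dual χ)).aestronglyMeasurable
    (.of_forall fun _ => by rw [RCLike.norm_conj]; exact (Circle.norm_coe _).le)

omit [NeZero p] in
theorem isOpen_coord_eq (k : ℤ) (a : ZMod p) : IsOpen {x : Vilenkin p | x k = a} := by
  refine isOpen_iff_forall_mem_open.2 fun x hx => ⟨coset (k + 1) x, fun y hy => ?_,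
    isOpen_coset _ _, mem_coset_self _ _⟩
  exact (mem_coset.1 hy k (by lia)).trans hx

/-- The vanishing of the Fourier transform is inherited by the restriction of a function to a
cylinder set. The indicator of `{x_k = a}` is a linear combination of powers of `r_k`. -/
theorem fourier_indicator_eq_zero {f : Vilenkin p → ℂ} (hf : Integrable f (haar p))
    (h : ∀ χ, fourier f χ = 0) (g : Vilenkin p) (S : Finset ℤ) (χ : dual p) :
    fourier ({x | ∀ k ∈ S, x k = g k}.indicator f) χ = 0 := by
  classical
  induction S using Finset.induction_on generalizing χ with
  | empty => simpa using h χ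
  | insert k S hk ih =>
    set F := {x : Vilenkin p | ∀ k ∈ S, x k = g k}.indicator f with hF
    have hm : MeasurableSet {x : Vilenkin p | ∀ k ∈ S, x k = g k} := by
      have : {x : Vilenkin p | ∀ k ∈ S, x k = g k} = ⋂ k ∈ S, {x | x k = g k} := by ext; simp
      rw [this]
      exact S.measurableSet_biInter fun k _ => (isOpen_coord_eq k _).measurableSet
    have hFi : Integrable F (haar p) := hf.indicator hm
    have e : {x : Vilenkin p | ∀ j ∈ insert k S, x j = g j}.indicator f = fun x =>
        (p : ℂ)⁻¹ * ∑ t : ZMod p, ZMod.stdAddChar (-(t * g k)) *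
          (F x * (rademacher p k ^ t.val).1 x) := by
      ext x
      have : ∀ t : ZMod p, ZMod.stdAddChar (-(t * g k)) * (F x * (rademacher p k ^ t.val).1 x) =
          F x * ZMod.stdAddChar (t * (x k - g k)) := by
        intro t
        rw [rademacher_pow_apply, ZMod.natCast_zmod_val, ← ZMod.stdAddChar_apply, mul_left_comm,
          ← AddChar.map_add_eq_mul]
        ring_nf
      simp only [this, ← Finset.mul_sum, sum_stdAddChar_mul, sub_eq_zero]
      simp only [hF, Set.indicator_apply, Set.mem_ofPred_eq, Finset.forall_mem_insert]
      have hp : (p : ℂ) ≠ 0 := NeZero.ne _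
      by_cases h1 : x k = g k <;> by_cases h2 : ∀ j ∈ S, x j = g j <;> simp [h1, h2]
      field_simp
    rw [e]
    unfold fourier
    simp only [mul_assoc, Finset.sum_mul]
    rw [integral_const_mul, integral_finsetSum]
    · refine mul_eq_zero_of_right _ (Finset.sum_eq_zero fun t _ => ?_)
      rw [integral_const_mul]
      have := fourier_mul_dual F χ (rademacher p k ^ t.val)
      rw [ih] at this
      unfold fourier at this
      simp only [mul_assoc] at this
      rw [this, mul_zero]
    · intro t _
      have := integrable_mul_conj_dual (integrable_mul_dual hFi (rademacher p k ^ t.val)) χ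
      simp only [mul_assoc] at this
      exact this.const_mul _

/-- An integrable function with vanishing Fourier transform is zero almost everywhere. A coset of
`G_n` is the decreasing intersection of cylinder sets, to which `fourier_indicator_eq_zero`
applies. -/
theorem ae_eq_zero_of_fourier_eq_zero {f : Vilenkin p → ℂ} (hf : Integrable f (haar p))
    (h : ∀ χ, fourier f χ = 0) : f =ᵐ[haar p] 0 := by
  refine ae_eq_zero_of_forall_setIntegral_coset (fun n g => hf.integrableOn) fun n g => ?_
  let C (N : ℕ) : Set (Vilenkin p) := {x | ∀ k ∈ Finset.Ico (-(N : ℤ)) n, x k = g k}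
  have hC : ⋂ N, C N = coset n g := by
    ext x
    simp only [C, Set.mem_iInter, mem_coset, Set.mem_ofPred_eq, Finset.mem_Ico]
    exact ⟨fun H k hk => H k.natAbs k ⟨by lia, hk⟩, fun H _ k hk => H k hk.2⟩
  have hm (N : ℕ) : MeasurableSet (C N) := by
    have : C N = ⋂ k ∈ Finset.Ico (-(N : ℤ)) n, {x | x k = g k} := by ext; simp [C]
    rw [this]
    exact Finset.measurableSet_biInter _ fun k _ => (isOpen_coord_eq k _).measurableSet
  have ha : Antitone C := fun M N hMN x hx k hk => hx k (by
    rw [Finset.mem_Ico] at hk ⊢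
    lia)
  have ht := tendsto_setIntegral_of_antitone hm ha ⟨0, hf.integrableOn⟩
  have h0 (N : ℕ) : ∫ x in C N, f x ∂(haar p) = 0 := by
    have := fourier_indicator_eq_zero hf h g (Finset.Ico (-(N : ℤ)) n) 1
    unfold fourier at this
    rw [← integral_indicator (hm N), ← this]
    congr 1
    ext x
    change _ = _ * conj ((1 : Circle) : ℂ)
    simp [C]
  simp only [h0, hC] at ht
  exact (tendsto_nhds_unique ht tendsto_const_nhds)

/-! ### Rooted trees and masks -/

/-- The residue `a` as a vertex of a tree with vertex set `{0, …, p - 1}`. -/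
def toVertex (a : ZMod p) : Fin p := ⟨a.val, a.val_lt⟩

theorem coe_toVertex (a : ZMod p) : (((toVertex a : Fin p) : ℕ) : ZMod p) = a :=
  ZMod.natCast_zmod_val a

theorem toVertex_coe (i : Fin p) : toVertex ((i : ℕ) : ZMod p) = i :=
  Fin.ext (ZMod.val_cast_of_lt i.2)

theorem toVertex_zero : toVertex (0 : ZMod p) = 0 := Fin.ext (by simp [toVertex])

theorem exists_isChild {T : SimpleGraph (Fin p)} (hT : T.IsTree) {i : Fin p} (hi : i ≠ 0) :
    ∃ j, IsChild T j i := by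
  obtain ⟨w, hw⟩ := hT.connected.exists_walk_length_eq_dist 0 i
  have hn : ¬ w.Nil := SimpleGraph.Walk.not_nil_of_ne hi.symm
  refine ⟨w.penultimate, w.adj_penultimate hn, ?_⟩
  have hl := SimpleGraph.dist_le w.dropLast
  have := hT.dist_eq_dist_add_one_of_adj 0 (w.adj_penultimate hn)
  simp at hl
  grind

theorem IsChild.unique {T : SimpleGraph (Fin p)} (hT : T.IsTree) {i j j' : Fin p}
    (h : IsChild T j i) (h' : IsChild T j' i) : j = j' := by
  -- The geodesics from `0` to `j` and to `j'`, extended by `i`, are paths from `0` to `i`.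
  have key {j : Fin p} (h : IsChild T j i) :
      ∃ w : T.Walk 0 i, w.IsPath ∧ w.penultimate = j := by
    obtain ⟨w, hw⟩ := hT.connected.exists_walk_length_eq_dist 0 j
    refine ⟨w.concat h.1, ?_, by simp⟩
    exact SimpleGraph.Walk.isPath_of_length_eq_dist _ (by rw [SimpleGraph.Walk.length_concat, hw, h.2])
  obtain ⟨w, hw, rfl⟩ := key h
  obtain ⟨w', hw', rfl⟩ := key h'
  rw [(hT.existsUnique_path 0 i).unique hw hw']

open Classical in
/-- The parent of a vertex, as a map on residues; the root `0` is its own parent. -/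
noncomputable def parent (T : SimpleGraph (Fin p)) (a : ZMod p) : ZMod p :=
  if h : ∃ j, IsChild T j (toVertex a) then ((h.choose : ℕ) : ZMod p) else 0

theorem not_isChild_zero (T : SimpleGraph (Fin p)) (j : Fin p) : ¬ IsChild T j 0 := fun h => by
  simpa using h.2

theorem parent_zero (T : SimpleGraph (Fin p)) : parent T 0 = 0 :=
  dif_neg fun ⟨j, hj⟩ => not_isChild_zero T j (by rwa [toVertex_zero] at hj)

theorem isChild_iff {T : SimpleGraph (Fin p)} (hT : T.IsTree) {j i : Fin p} :
    IsChild T j i ↔ i ≠ 0 ∧ ((j : ℕ) : ZMod p) = parent T ((i : ℕ) : ZMod p) := by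
  have key (hi : i ≠ 0) : ∃ j', IsChild T j' i ∧ parent T ((i : ℕ) : ZMod p) = ((j' : ℕ) : ZMod p) := by
    have h : ∃ j', IsChild T j' (toVertex ((i : ℕ) : ZMod p)) := by
      rw [toVertex_coe]
      exact exists_isChild hT hi
    exact ⟨h.choose, by simpa only [toVertex_coe] using h.choose_spec, dif_pos h⟩
  constructor
  · intro h
    have hi : i ≠ 0 := by rintro rfl; exact not_isChild_zero T j h
    obtain ⟨j', hj', e⟩ := key hi
    exact ⟨hi, by rw [e, h.unique hT hj']⟩
  · rintro ⟨hi, h⟩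
    obtain ⟨j', hj', e⟩ := key hi
    rw [e] at h
    rwa [← toVertex_coe j, h, toVertex_coe]

/-- The distance to the root drops by one at each passage to the parent, so after finitely many
passages, uniformly in the vertex, the root is reached. -/
theorem exists_iterate_parent_eq_zero {T : SimpleGraph (Fin p)} (hT : T.IsTree) :
    ∃ D : ℕ, ∀ a, (parent T)^[D] a = 0 := by
  have key (n : ℕ) : ∀ a : ZMod p, T.dist 0 (toVertex a) ≤ n → (parent T)^[n] a = 0 := by
    induction n with
    | zero =>
      intro a ha
      have : toVertex a = 0 := by
        by_contra h
        exact h (hT.connected.dist_eq_zero_iff.1 (Nat.le_zero.1 ha)).symm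
      rw [Function.iterate_zero, id, ← coe_toVertex a, this]
      simp
    | succ n ih =>
      intro a ha
      rw [Function.iterate_succ_apply]
      by_cases h : toVertex a = 0
      · have : a = 0 := by rw [← coe_toVertex a, h]; simp
        rw [this, parent_zero]
        exact Function.iterate_fixed (parent_zero T) n
      · obtain ⟨j, hj⟩ := exists_isChild hT h
        have e := ((isChild_iff hT).1 hj).2
        rw [coe_toVertex] at e
        apply ih
        rw [← e, toVertex_coe]
        have := hj.2
        lia
  refine ⟨Finset.univ.sup fun a : ZMod p => T.dist 0 (toVertex a), fun a => key _ a ?_⟩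
  exact Finset.le_sup (f := fun a : ZMod p => T.dist 0 (toVertex a)) (Finset.mem_univ a)

theorem mem_treeSet_iff {T : SimpleGraph (Fin p)} (hT : T.IsTree) {χ : dual p} :
    χ ∈ treeSet T ↔ χ ∈ annihilator p 1 ∧ coef χ 0 = parent T (coef χ (-1)) := by
  constructor
  · rintro (h | ⟨j, i, hij, ζ, hζ, rfl⟩)
    · have h' := mem_annihilator_iff.1 h
      refine ⟨mem_annihilator_iff.2 fun k hk => h' k (by lia), ?_⟩
      rw [h' 0 (by lia), h' (-1) le_rfl, parent_zero]
    · have h' := mem_annihilator_iff.1 hζ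
      refine ⟨mem_annihilator_iff.2 fun k hk => ?_, ?_⟩
      · simp [coef_rademacher, h' k (by lia), show k ≠ -1 by lia, show k ≠ 0 by lia]
      · simp [coef_rademacher, h' 0 (by lia), h' (-1) le_rfl, ((isChild_iff hT).1 hij).2]
  · rintro ⟨h, h0⟩
    have h' := mem_annihilator_iff.1 h
    by_cases hi : coef χ (-1) = 0
    · left
      refine mem_annihilator_iff.2 fun k hk => ?_
      rw [hi, parent_zero] at h0
      obtain rfl | rfl | hk : k = -1 ∨ k = 0 ∨ 1 ≤ k := by lia
      exacts [hi, h0, h' k hk]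
    · right
      have hi' : toVertex (coef χ (-1)) ≠ 0 := fun e => hi (by
        rw [← coe_toVertex (coef χ (-1)), e]; simp)
      refine ⟨toVertex (coef χ 0), toVertex (coef χ (-1)), (isChild_iff hT).2 ⟨hi', by
        rw [coe_toVertex, coe_toVertex, h0]⟩,
        χ * (rademacher p (-1) ^ (toVertex (coef χ (-1)) : ℕ) *
          rademacher p 0 ^ (toVertex (coef χ 0) : ℕ))⁻¹, mem_annihilator_iff.2 fun k hk => ?_, ?_⟩
      · obtain rfl | rfl | hk : k = -1 ∨ k = 0 ∨ 1 ≤ k := by lia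
        · simp [coef_rademacher, coe_toVertex]
        · simp [coef_rademacher, coe_toVertex]
        · simp [coef_rademacher, h' k hk, show k ≠ -1 by lia, show k ≠ 0 by lia]
      · rw [mul_assoc, inv_mul_cancel_right]

theorem exists_generatesMask {T : SimpleGraph (Fin p)} (hT : T.IsTree) :
    ∃ m₀ : dual p → ℂ, GeneratesMask T m₀ := by
  classical
  refine ⟨fun χ => if coef χ 0 = parent T (coef χ (-1)) then 1 else 0, ?_, ?_, ?_, ?_, ?_⟩
  · intro χ ζ hζ
    have h := mem_annihilator_iff.1 hζ
    simp [h 0 (by lia), h (-1) le_rfl]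
  · intro ζ hζ
    have h := mem_annihilator_iff.1 hζ
    simp [h 0 (by lia), h (-1) le_rfl, parent_zero]
  · intro χ hχ
    simp [((mem_treeSet_iff hT).1 hχ).2]
  · intro χ h1 h2
    exact if_neg fun h => h2 ((mem_treeSet_iff hT).2 ⟨h1, h⟩)
  · intro χ s α
    have h (k : ℤ) (hk : k ≤ 0) :
        coef (∏ j ∈ Finset.Icc 1 s, rademacher p (j : ℤ) ^ (α j : ℕ)) k = 0 := by
      rw [coef_prod]
      refine Finset.sum_eq_zero fun j hj => ?_
      rw [coef_pow, coef_rademacher, if_neg (by have := (Finset.mem_Icc.1 hj).1; lia), mul_zero]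
    simp [h 0 le_rfl, h (-1) (by lia)]

open Classical in
/-- A mask is determined by the coordinates of its argument at the indices `-1` and `0`: it is
supported where the second one is the parent of the first one, and unimodular there. -/
theorem GeneratesMask.exists_eq {T : SimpleGraph (Fin p)} (hT : T.IsTree) {m₀ : dual p → ℂ}
    (h : GeneratesMask T m₀) : ∃ l : ZMod p → ℂ, (∀ a, ‖l a‖ = 1) ∧ l 0 = 1 ∧
      ∀ χ, m₀ χ = if coef χ 0 = parent T (coef χ (-1)) then l (coef χ (-1)) else 0 := by
  let R (a b : ZMod p) : dual p :=
    rademacher p (-1) ^ (toVertex a : ℕ) * rademacher p 0 ^ (toVertex b : ℕ)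
  have c1 (a b : ZMod p) : coef (R a b) (-1) = a := by simp [R, coef_rademacher, coe_toVertex]
  have c0 (a b : ZMod p) : coef (R a b) 0 = b := by simp [R, coef_rademacher, coe_toVertex]
  have c (a b : ZMod p) (k : ℤ) (hk : 1 ≤ k) : coef (R a b) k = 0 := by
    simp [R, coef_rademacher, show k ≠ -1 by lia, show k ≠ 0 by lia]
  have hR (a b : ZMod p) : R a b ∈ annihilator p 1 := mem_annihilator_iff.2 fun k hk => c a b k hk
  have hm (χ : dual p) : m₀ χ = m₀ (R (coef χ (-1)) (coef χ 0)) := by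
    obtain ⟨M, hM⟩ := exists_mem_annihilator χ
    have hM' := mem_annihilator_iff.1 hM
    let α (k : ℕ) : Fin p := toVertex (coef χ k)
    set P := ∏ k ∈ Finset.Icc 1 M, rademacher p (k : ℤ) ^ (α k : ℕ) with hP
    have hPc (k : ℤ) (hk : k ≤ 0) : coef P k = 0 := by
      rw [coef_prod]
      refine Finset.sum_eq_zero fun j hj => ?_
      rw [coef_pow, coef_rademacher, if_neg (by have := (Finset.mem_Icc.1 hj).1; lia), mul_zero]
    have hPk (k : ℕ) (hk : 1 ≤ k) : coef P k = coef χ k := by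
      rw [coef_prod]
      simp only [coef_pow, coef_rademacher, Nat.cast_inj, α, coe_toVertex, mul_ite, mul_one,
        mul_zero, Finset.sum_ite_eq, Finset.mem_Icc]
      split_ifs with hkM
      · rfl
      · exact (hM' k (by lia)).symm
    set S := R (coef χ (-1)) (coef χ 0) with hS
    have hζ : χ * (S * P)⁻¹ ∈ annihilator p (-1) := by
      refine mem_annihilator_iff.2 fun k hk => ?_
      rw [coef_mul, coef_inv, coef_mul]
      obtain rfl | rfl | hk : k = -1 ∨ k = 0 ∨ 1 ≤ k := by lia
      · rw [hPc _ (by lia), hS, c1]; ring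
      · rw [hPc _ (by lia), hS, c0]; ring
      · lift k to ℕ using by lia
        rw [hPk k (by lia), hS, c _ _ _ hk]; ring
    have e1 := h.const_on_cosets (S * P) _ hζ
    rw [inv_mul_cancel_right] at e1
    rw [e1]
    exact h.periodic S M α
  refine ⟨fun a => m₀ (R a (parent T a)), fun a => ?_, ?_, fun χ => ?_⟩
  · exact h.norm_eq_one _ ((mem_treeSet_iff hT).2 ⟨hR _ _, by rw [c0, c1]⟩)
  · refine h.eq_one _ (mem_annihilator_iff.2 fun k hk => ?_)
    obtain rfl | rfl | hk : k = -1 ∨ k = 0 ∨ 1 ≤ k := by lia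
    exacts [c1 _ _, by rw [c0, parent_zero], c _ _ k hk]
  · rw [hm χ]
    split_ifs with h0
    · rw [h0]
    · refine h.eq_zero _ (hR _ _) fun hmem => h0 ?_
      have := ((mem_treeSet_iff hT).1 hmem).2
      rwa [c0, c1] at this

/-! ### The scaling function of a nilpotent parent map -/

/-- The character `χ_a = ∏_{k < D} r_{k-1}^{π^k(a)}` whose coordinates at `-1, 0, 1, …` are the
successive ancestors of `a` under the map `π`. -/
noncomputable def pathChar (π : ZMod p → ZMod p) (D : ℕ) (a : ZMod p) : dual p :=
  ∏ k ∈ Finset.range D, rademacher p ((k : ℤ) - 1) ^ (π^[k] a).val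

theorem coe_pathChar_apply (π : ZMod p → ZMod p) (D : ℕ) (a : ZMod p) (x : Vilenkin p) :
    ((pathChar π D a).1 x : ℂ) =
      ∏ k ∈ Finset.range D, ZMod.stdAddChar (π^[k] a * x ((k : ℤ) - 1)) := by
  unfold pathChar
  induction D with
  | zero => simp
  | succ D ih =>
    rw [Finset.prod_range_succ, Finset.prod_range_succ, ← ih, ZMod.stdAddChar_apply]
    have := rademacher_pow_apply ((D : ℤ) - 1) (π^[D] a).val x
    rw [ZMod.natCast_zmod_val] at this
    rw [← this]
    rfl

section Nilpotent

variable {π : ZMod p → ZMod p} {D : ℕ}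

omit [NeZero p] in
theorem iterate_eq_zero_of_le (h0 : π 0 = 0) (hD : ∀ a, π^[D] a = 0) {k : ℕ} (hk : D ≤ k)
    (a : ZMod p) : π^[k] a = 0 := by
  obtain ⟨j, rfl⟩ := Nat.exists_eq_add_of_le' hk
  rw [Function.iterate_add_apply, hD]
  exact Function.iterate_fixed h0 j

theorem coef_pathChar (h0 : π 0 = 0) (hD : ∀ a, π^[D] a = 0) (a : ZMod p) (k : ℕ) :
    coef (pathChar π D a) ((k : ℤ) - 1) = π^[k] a := by
  rw [pathChar, coef_prod]
  simp only [coef_pow, coef_rademacher, sub_left_inj, Nat.cast_inj, ZMod.natCast_zmod_val,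
    mul_ite, mul_one, mul_zero, Finset.sum_ite_eq, Finset.mem_range]
  split_ifs with h
  · rfl
  · exact (iterate_eq_zero_of_le h0 hD (not_lt.1 h) a).symm

theorem coef_pathChar_neg_one (h0 : π 0 = 0) (hD : ∀ a, π^[D] a = 0) (a : ZMod p) :
    coef (pathChar π D a) (-1) = a := by
  simpa using coef_pathChar h0 hD a 0

theorem pathChar_zero_apply (h0 : π 0 = 0) (x : Vilenkin p) :
    ((pathChar π D 0).1 x : ℂ) = 1 := by
  rw [coe_pathChar_apply]
  refine Finset.prod_eq_one fun k _ => ?_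
  rw [Function.iterate_fixed h0, zero_mul, AddChar.map_zero_eq_one]

/-- The self-similarity of the characters `χ_a`, on which refinability rests. -/
theorem pathChar_apply_eq (hD : ∀ a, π^[D] a = 0) (a : ZMod p) (x : Vilenkin p) :
    ((pathChar π D a).1 x : ℂ) =
      ZMod.stdAddChar (a * x (-1)) * (pathChar π D (π a)).1 (dilation p x) := by
  simp only [coe_pathChar_apply]
  have h := Finset.prod_range_succ
    (fun k : ℕ => ZMod.stdAddChar (N := p) (π^[k] a * x ((k : ℤ) - 1))) D
  rw [Finset.prod_range_succ', hD, zero_mul, AddChar.map_zero_eq_one, mul_one] at h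
  rw [← h, mul_comm]
  congr 1
  refine Finset.prod_congr rfl fun k _ => ?_
  rw [dilation_apply, Function.iterate_succ_apply]
  push_cast
  ring_nf

/-- The function `1_{G_{-1} + h} χ_a`. -/
noncomputable def atom (π : ZMod p → ZMod p) (D : ℕ) (h : Vilenkin p) (a : ZMod p) :
    Vilenkin p → ℂ :=
  (coset (-1) h).indicator fun x => ((pathChar π D a).1 x : ℂ)

/-- The function `φ = p⁻¹ 1_{G_{-1}} ∑_a c_a χ_a`. Its Fourier transform is `c_a` on
`G_{-1}^⊥ χ_a` and zero elsewhere. -/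
noncomputable def scalingFun (π : ZMod p → ZMod p) (D : ℕ) (c : ZMod p → ℂ) : Vilenkin p → ℂ :=
  fun x => ∑ a, (p : ℂ)⁻¹ * c a * atom π D 0 a x

theorem atom_eq_ite (π : ZMod p → ZMod p) (D : ℕ) {h : Vilenkin p} (a : ZMod p) {x : Vilenkin p}
    {P : Prop} [Decidable P] (hP : x ∈ coset (-1) h ↔ P) :
    atom π D h a x = if P then ((pathChar π D a).1 x : ℂ) else 0 := by
  unfold atom
  split_ifs with hx
  · exact Set.indicator_of_mem (hP.2 hx) _
  · exact Set.indicator_of_notMem (mt hP.1 hx) _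

theorem atom_congr (π : ZMod p → ZMod p) (D : ℕ) {g h : Vilenkin p} (hgh : g ∈ coset (-1) h)
    (a : ZMod p) : atom π D g a = atom π D h a := by
  unfold atom
  rw [coset_eq_of_mem hgh]

theorem atom_sub (π : ZMod p → ZMod p) (D : ℕ) (h : Vilenkin p) (a : ZMod p) (x : Vilenkin p) :
    atom π D 0 a (x - h) = (pathChar π D a).1 (-h) * atom π D h a x := by
  classical
  have : x - h ∈ coset (-1) 0 ↔ x ∈ coset (-1) h := by simp [coset]
  rw [atom_eq_ite π D a this, atom_eq_ite π D a Iff.rfl]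
  split_ifs
  · rw [sub_eq_add_neg, dual_map_add, mul_comm, Circle.coe_mul]
  · simp

theorem scalingFun_sub (c : ZMod p → ℂ) (h x : Vilenkin p) :
    scalingFun π D c (x - h) =
      ∑ a, (p : ℂ)⁻¹ * c a * (pathChar π D a).1 (-h) * atom π D h a x := by
  simp only [scalingFun, atom_sub, mul_assoc]

/-- The functions `1_{G_{-1} + g} χ_a` are recovered from the shifts of the scaling function by
inversion of the discrete Fourier transform on `ℤ/p`. -/
theorem exists_atom_eq_sum (h0 : π 0 = 0) (hD : ∀ a, π^[D] a = 0) {c : ZMod p → ℂ}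
    (hc : ∀ a, ‖c a‖ = 1) (g : Vilenkin p) (a : ZMod p) :
    ∃ (z : ZMod p → ℂ) (h : ZMod p → Vilenkin p), (∀ t, h t ∈ H₀ p) ∧
      ∀ x, atom π D g a x = ∑ t, z t * scalingFun π D c (x - h t) := by
  obtain ⟨m, hm⟩ := g.2
  let g' : Vilenkin p := ⟨fun k => if k < -1 then g k else 0, m, fun k hk => by
    dsimp only
    split_ifs
    · exact hm k hk
    · rfl⟩
  have hg' (k : ℤ) : g' k = if k < -1 then g k else 0 := rfl
  have hgg' : g ∈ coset (-1) g' := mem_coset.2 fun k hk => by rw [hg', if_pos hk]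
  have hz : c a * (pathChar π D a).1 (-g') ≠ 0 :=
    mul_ne_zero (fun h => by simpa [h] using hc a) (Circle.coe_ne_zero _)
  refine ⟨fun t => (c a * (pathChar π D a).1 (-g'))⁻¹ * ZMod.stdAddChar (t * a),
    fun t => g' + single (-1) t, fun t k hk => ?_, fun x => ?_⟩
  · rw [add_apply, hg', single_apply, if_neg (by lia), if_neg (by lia), add_zero]
  · have e (t b : ZMod p) : atom π D (g' + single (-1) t) b = atom π D g' b := by
      refine atom_congr π D (mem_coset.2 fun k hk => ?_) b
      rw [add_apply, single_apply, if_neg (by lia), add_zero]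
    have e' (t b : ZMod p) : ((pathChar π D b).1 (-(g' + single (-1) t)) : ℂ) =
        (pathChar π D b).1 (-g') * ZMod.stdAddChar (-(b * t)) := by
      rw [neg_add, dual_map_add, Circle.coe_mul, AddChar.map_neg_eq_inv _ (single (-1) t),
        apply_single, coef_pathChar_neg_one h0 hD, ← AddChar.map_neg_eq_inv, ZMod.stdAddChar_apply]
    have e'' (t b : ZMod p) : (ZMod.stdAddChar (t * a) * ZMod.stdAddChar (-(b * t)) : ℂ) =
        ZMod.stdAddChar (t * (a - b)) := by
      rw [← AddChar.map_add_eq_mul]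
      ring_nf
    have hp : (p : ℂ) ≠ 0 := NeZero.ne _
    calc atom π D g a x
        = (c a * (pathChar π D a).1 (-g'))⁻¹ * ((p : ℂ)⁻¹ * c a * (pathChar π D a).1 (-g') *
            atom π D g' a x * p) := by
          rw [atom_congr π D hgg', eq_inv_mul_iff_mul_eq₀ hz]
          field_simp
      _ = (c a * (pathChar π D a).1 (-g'))⁻¹ * ∑ b, (p : ℂ)⁻¹ * c b * (pathChar π D b).1 (-g') *
            atom π D g' b x * ∑ t, ZMod.stdAddChar (t * (a - b)) := by
          congr 1
          simp only [sum_stdAddChar_mul, sub_eq_zero]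
          simp
      _ = _ := by
          simp only [scalingFun_sub, e, e', Finset.mul_sum, ← e'']
          rw [Finset.sum_comm]
          refine Finset.sum_congr rfl fun t _ => Finset.sum_congr rfl fun b _ => ?_
          ring

/-- Refinement: `G_{-1} + h` is the union of `p` cosets of `G_0`, and on each of them `χ_a` is a
constant multiple of `χ_{π a} ∘ A`. -/
theorem atom_eq_sum_dilation (hD : ∀ a, π^[D] a = 0) (h : Vilenkin p) (a : ZMod p)
    (x : Vilenkin p) :
    atom π D h a x = ∑ t, ZMod.stdAddChar (a * (h (-1) + t)) *
      atom π D (dilation p (h + single (-1) t)) (π a) (dilation p x) := by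
  have key (t : ZMod p) : dilation p x ∈ coset (-1) (dilation p (h + single (-1) t)) ↔
      x ∈ coset (-1) h ∧ t = x (-1) - h (-1) := by
    rw [← Set.mem_preimage, dilation_preimage_coset, AddEquiv.symm_apply_apply]
    simp only [mem_coset, add_apply, single_apply]
    constructor
    · intro H
      refine ⟨fun k hk => ?_, ?_⟩
      · simpa [hk.ne] using H k (by lia)
      · rw [H (-1) (by lia)]; simp
    · rintro ⟨H, rfl⟩ k hk
      split_ifs with h1
      · rw [h1]; ring
      · rw [H k (by lia), add_zero]
  classical
  rw [atom_eq_ite π D a Iff.rfl]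
  simp only [fun t => atom_eq_ite π D (π a) (key t)]
  by_cases hx : x ∈ coset (-1) h
  · simp only [hx, true_and, if_true, mul_ite, mul_zero, Finset.sum_ite_eq', Finset.mem_univ]
    rw [pathChar_apply_eq hD]
    ring_nf
  · simp [hx]

/-- The function `1_{G_{-1} + h} χ_a` is constant on the cosets of `G_{D-1}`. -/
theorem atom_eq_of_mem_coset (h : Vilenkin p) (a : ZMod p) {x y : Vilenkin p}
    (hxy : x ∈ coset ((D : ℤ) - 1) y) : atom π D h a x = atom π D h a y := by
  have h1 := mem_coset.1 hxy
  have : x ∈ coset (-1) h ↔ y ∈ coset (-1) h := by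
    simp only [mem_coset]
    exact forall₂_congr fun k hk => by rw [h1 k (by lia)]
  classical
  rw [atom_eq_ite π D a this, atom_eq_ite π D a Iff.rfl, coe_pathChar_apply, coe_pathChar_apply]
  split_ifs
  · refine Finset.prod_congr rfl fun k hk => ?_
    rw [h1 _ (by have := Finset.mem_range.1 hk; lia)]
  · rfl

theorem memLp_atom (h : Vilenkin p) (a : ZMod p) (q : ENNReal) :
    MemLp (atom π D h a) q (haar p) := by
  unfold atom
  rw [memLp_indicator_iff_restrict (measurableSet_coset _ _)]
  have : IsFiniteMeasure ((haar p).restrict (coset (-1) h)) :=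
    ⟨by rw [Measure.restrict_apply_univ]; exact (haar_coset_ne_top _ _).lt_top⟩
  exact MemLp.of_bound (continuous_dual _).aestronglyMeasurable 1
    (.of_forall fun _ => (Circle.norm_coe _).le)

theorem memLp_scalingFun (c : ZMod p → ℂ) (q : ENNReal) :
    MemLp (scalingFun π D c) q (haar p) :=
  memLp_finsetSum _ fun a _ => (memLp_atom 0 a q).const_mul _

theorem isStepFunction_scalingFun (c : ZMod p → ℂ) : IsStepFunction (scalingFun π D c) := by
  refine ⟨D, 1, fun x hx => ?_, fun x y hy => ?_⟩
  · obtain ⟨a, -, ha⟩ := Finset.exists_ne_zero_of_sum_ne_zero hx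
    have := Set.mem_of_indicator_ne_zero (right_ne_zero_of_mul ha)
    rw [coset_zero] at this
    exact this
  · refine Finset.sum_congr rfl fun a _ => ?_
    rw [atom_eq_of_mem_coset 0 a (y := x)]
    refine mem_coset.2 fun k hk => ?_
    rw [add_apply, hy k (by lia), add_zero]

open Classical in
theorem fourier_scalingFun (c : ZMod p → ℂ) (χ : dual p) :
    fourier (scalingFun π D c) χ =
      ∑ a, if pathChar π D a * χ⁻¹ ∈ annihilator p (-1) then c a else 0 := by
  have e (a : ZMod p) : ∫ x, atom π D 0 a x * conj (χ.1 x : ℂ) ∂(haar p) =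
      if pathChar π D a * χ⁻¹ ∈ annihilator p (-1) then (p : ℂ) else 0 := by
    have := setIntegral_coset_dual (pathChar π D a * χ⁻¹) (-1) 0
    rw [← integral_indicator (measurableSet_coset _ _), AddChar.map_zero_eq_one] at this
    simp only [neg_neg, zpow_one, Circle.coe_one, mul_one] at this
    rw [← this]
    congr 1
    ext x
    simp only [atom, Set.indicator_apply]
    split_ifs
    · change _ = (((pathChar π D a).1 x * χ.1 (-x) : Circle) : ℂ)
      rw [AddChar.map_neg_eq_inv, Circle.coe_mul, Circle.coe_inv_eq_conj]
    · simp
  have hp : (p : ℂ) ≠ 0 := NeZero.ne _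
  simp only [fourier, scalingFun, Finset.sum_mul, mul_assoc]
  rw [integral_finsetSum]
  · refine Finset.sum_congr rfl fun a _ => ?_
    rw [integral_const_mul, integral_const_mul, e]
    split_ifs
    · field_simp
    · simp
  · intro a _
    exact ((integrable_mul_conj_dual (memLp_one_iff_integrable.1 (memLp_atom 0 a 1)) χ).const_mul
      _).const_mul _

theorem pathChar_mul_inv_mem_iff (h0 : π 0 = 0) (hD : ∀ a, π^[D] a = 0) {a : ZMod p}
    {χ : dual p} : pathChar π D a * χ⁻¹ ∈ annihilator p (-1) ↔
      a = coef χ (-1) ∧ ∀ n : ℕ, coef χ n = π (coef χ ((n : ℤ) - 1)) := by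
  rw [mem_annihilator_iff]
  simp only [coef_mul, coef_inv, ← sub_eq_add_neg, sub_eq_zero]
  constructor
  · intro h
    have h' (n : ℕ) : coef χ ((n : ℤ) - 1) = π^[n] a := by
      rw [← h _ (by lia), coef_pathChar h0 hD]
    refine ⟨by simpa using (h' 0).symm, fun n => ?_⟩
    have := h' (n + 1)
    rw [Function.iterate_succ_apply', ← h' n] at this
    simpa using this
  · rintro ⟨rfl, h⟩ k hk
    obtain ⟨n, rfl⟩ : ∃ n : ℕ, k = n - 1 := ⟨(k + 1).toNat, by lia⟩
    rw [coef_pathChar h0 hD]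
    clear hk
    induction n with
    | zero => simp
    | succ n ih =>
      rw [Function.iterate_succ_apply', ih, ← h n]
      simp

open Classical in
theorem fourier_scalingFun_eq (h0 : π 0 = 0) (hD : ∀ a, π^[D] a = 0) (c : ZMod p → ℂ)
    (χ : dual p) : fourier (scalingFun π D c) χ =
      if ∀ n : ℕ, coef χ n = π (coef χ ((n : ℤ) - 1)) then c (coef χ (-1)) else 0 := by
  rw [fourier_scalingFun]
  simp only [pathChar_mul_inv_mem_iff h0 hD]
  split_ifs with h <;> simp [h]

/-- If the mask is `l(α)` where the coordinates `(α, β)` at `(-1, 0)` satisfy `β = π α`, and zero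
elsewhere, then the infinite product is the Fourier transform of the scaling function whose
coefficients `c_a` are the products of `l` over the ancestors of `a`. -/
theorem hasProd_fourier_scalingFun (h0 : π 0 = 0) (hD : ∀ a, π^[D] a = 0) {l : ZMod p → ℂ}
    (hl : l 0 = 1) {m₀ : dual p → ℂ} (hm1 : ∀ χ, coef χ 0 = π (coef χ (-1)) → m₀ χ = l (coef χ (-1)))
    (hm0 : ∀ χ, coef χ 0 ≠ π (coef χ (-1)) → m₀ χ = 0) (χ : dual p) :
    HasProd (fun n : ℕ => m₀ ((dualDilationInv p)^[n] χ))
      (fourier (scalingFun π D fun a => ∏ k ∈ Finset.range D, l (π^[k] a)) χ) := by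
  classical
  rw [fourier_scalingFun_eq h0 hD]
  have c0 (n : ℕ) : coef ((dualDilationInv p)^[n] χ) 0 = coef χ n := by
    rw [coef_iterate_dualDilationInv, zero_add]
  have c1 (n : ℕ) : coef ((dualDilationInv p)^[n] χ) (-1) = coef χ ((n : ℤ) - 1) := by
    rw [coef_iterate_dualDilationInv, neg_add_eq_sub]
  split_ifs with h
  · have hc (n : ℕ) : coef χ ((n : ℤ) - 1) = π^[n] (coef χ (-1)) := by
      induction n with
      | zero => simp
      | succ n ih =>
        rw [Function.iterate_succ_apply', ← ih, ← h n]
        simp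
    have e (n : ℕ) : m₀ ((dualDilationInv p)^[n] χ) = l (π^[n] (coef χ (-1))) := by
      rw [hm1 _ (by rw [c0, c1, h]), c1, hc]
    simp only [e]
    refine hasProd_prod_of_ne_finset_one fun k hk => ?_
    rw [iterate_eq_zero_of_le h0 hD (by simpa using hk), hl]
  · push Not at h
    obtain ⟨n, hn⟩ := h
    exact hasProd_zero_of_exists_eq_zero ⟨n, hm0 _ (by rwa [c0, c1])⟩

open Classical in
/-- The shifts of the scaling function are orthonormal. On `G_{-1}` this is the orthogonality of
the characters of `ℤ/p`; shifts by elements of `H_0` outside `G_{-1}` have disjoint supports. -/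
theorem integral_scalingFun_shift (h0 : π 0 = 0) (hD : ∀ a, π^[D] a = 0) {c : ZMod p → ℂ}
    (hc : ∀ a, ‖c a‖ = 1) {h : Vilenkin p} (hh : h ∈ H₀ p) :
    ∫ x, scalingFun π D c (x - h) * conj (scalingFun π D c x) ∂(haar p) =
      if h = 0 then 1 else 0 := by
  have hsupp {x : Vilenkin p} (hx : x ∉ coset (-1) 0) : scalingFun π D c x = 0 :=
    Finset.sum_eq_zero fun a _ => by rw [atom, Set.indicator_of_notMem hx, mul_zero]
  by_cases hm : h ∈ coset (-1) 0
  · have hshift (x : Vilenkin p) : x - h ∈ coset (-1) 0 ↔ x ∈ coset (-1) 0 := by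
      have hm' := mem_coset.1 hm
      simp only [mem_coset, sub_apply]
      exact forall₂_congr fun k hk => by rw [hm' k hk, zero_apply, sub_zero]
    have e1 (x : Vilenkin p) : scalingFun π D c (x - h) * conj (scalingFun π D c x) =
        ∑ a, (p : ℂ)⁻¹ * conj (c a) *
          (scalingFun π D c (x - h) * conj ((pathChar π D a).1 x : ℂ)) := by
      by_cases hx : x ∈ coset (-1) 0
      · rw [scalingFun.eq_def π D c x, map_sum, Finset.mul_sum]
        refine Finset.sum_congr rfl fun a _ => ?_
        rw [atom, Set.indicator_of_mem hx]
        simp only [map_mul, map_inv₀, Complex.conj_natCast]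
        ring
      · rw [hsupp (mt (hshift x).1 hx)]
        simp
    have hi := memLp_one_iff_integrable.1 (memLp_scalingFun (π := π) (D := D) c 1)
    have e2 (a : ZMod p) : ∫ x, scalingFun π D c (x - h) * conj ((pathChar π D a).1 x : ℂ) ∂(haar p)
        = conj (ZMod.stdAddChar (a * h (-1))) * c a := by
      have hs : h = single (-1) (h (-1)) := by
        ext k
        rw [single_apply]
        split_ifs with hk
        · rw [hk]
        · rcases lt_or_ge k (-1) with h1 | h1
          · exact mem_coset.1 hm k h1
          · exact hh k (by lia)
      rw [← integral_add_right_eq_self _ h]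
      simp only [add_sub_cancel_right, dual_map_add, Circle.coe_mul, map_mul]
      simp only [← mul_assoc]
      rw [integral_mul_const]
      change fourier _ _ * _ = _
      rw [fourier_scalingFun_eq h0 hD, if_pos, coef_pathChar_neg_one h0 hD, mul_comm]
      · congr 2
        conv_lhs => rw [hs]
        rw [apply_single, coef_pathChar_neg_one h0 hD, ZMod.stdAddChar_apply]
      · exact ((pathChar_mul_inv_mem_iff h0 hD (a := a)).1 (by
          rw [mul_inv_cancel]; exact one_mem _)).2
    simp only [e1]
    rw [integral_finsetSum _ fun a _ =>
      (integrable_mul_conj_dual (hi.comp_sub_right h) (pathChar π D a)).const_mul _]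
    simp only [integral_const_mul, e2]
    have e3 (a : ZMod p) : (p : ℂ)⁻¹ * conj (c a) * (conj (ZMod.stdAddChar (a * h (-1))) * c a) =
        (p : ℂ)⁻¹ * conj (ZMod.stdAddChar (a * h (-1))) := by
      have : conj (c a) * c a = 1 := by rw [Complex.conj_mul', hc]; simp
      linear_combination (p : ℂ)⁻¹ * conj (ZMod.stdAddChar (a * h (-1))) * this
    simp only [e3]
    rw [← Finset.mul_sum, ← map_sum, sum_stdAddChar_mul]
    have hp : (p : ℂ) ≠ 0 := NeZero.ne _
    have : h = 0 ↔ h (-1) = 0 := by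
      refine ⟨fun e => by rw [e]; rfl, fun e => ?_⟩
      ext k
      rcases lt_trichotomy k (-1) with h1 | rfl | h1
      · exact mem_coset.1 hm k h1
      · exact e
      · exact hh k (by lia)
    simp only [this]
    split_ifs
    · simp [hp]
    · simp
  · rw [if_neg (by rintro rfl; exact hm (mem_coset_self _ _))]
    refine integral_eq_zero_of_ae (.of_forall fun x => ?_)
    by_cases hx : x ∈ coset (-1) 0
    · have : x - h ∉ coset (-1) 0 := fun hxh => hm (mem_coset.2 fun k hk => by
        have h1 := mem_coset.1 hx k hk
        have h2 := mem_coset.1 hxh k hk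
        rw [sub_apply, h1] at h2
        simpa using h2)
      simp [hsupp this]
    · simp [hsupp hx]

end Nilpotent

/-! ### Closed spans of classes of functions -/

theorem ClassMem.mem {f : Vilenkin p → ℂ} {V : Submodule ℂ (L₂ p)} (hf : ClassMem f V) {u : L₂ p}
    (h : (u : Vilenkin p → ℂ) =ᵐ[haar p] f) : u ∈ V := by
  obtain ⟨v, hv, e⟩ := hf
  rwa [Lp.ext (h.trans e.symm)]

theorem ClassMem.sum {ι : Type*} (s : Finset ι) (z : ι → ℂ) {F : ι → Vilenkin p → ℂ}
    {V : Submodule ℂ (L₂ p)} (hF : ∀ i ∈ s, ClassMem (F i) V) :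
    ClassMem (fun x => ∑ i ∈ s, z i * F i x) V := by
  classical
  induction s using Finset.induction_on with
  | empty => exact ⟨0, zero_mem V, by simpa using! Lp.coeFn_zero ℂ 2 (haar p)⟩
  | insert a s ha ih =>
    obtain ⟨u, hu, eu⟩ := hF a (Finset.mem_insert_self a s)
    obtain ⟨v, hv, ev⟩ := ih fun i hi => hF i (Finset.mem_insert_of_mem hi)
    refine ⟨z a • u + v, add_mem (V.smul_mem _ hu) hv, ?_⟩
    filter_upwards [eu, ev, Lp.coeFn_add (z a • u) v, Lp.coeFn_smul (z a) u] with x h1 h2 h3 h4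
    rw [Finset.sum_insert ha, h3, Pi.add_apply, h4, Pi.smul_apply, h1, h2, smul_eq_mul]

/-- The closed linear span in `L₂` of the classes of the functions in `S`. -/
noncomputable def closedSpan (S : Set (Vilenkin p → ℂ)) : Submodule ℂ (L₂ p) :=
  (Submodule.span ℂ {u : L₂ p | ∃ f ∈ S, (u : Vilenkin p → ℂ) =ᵐ[haar p] f}).topologicalClosure

theorem isClosed_closedSpan (S : Set (Vilenkin p → ℂ)) :
    IsClosed (closedSpan S : Set (L₂ p)) :=
  Submodule.isClosed_topologicalClosure _

theorem mem_closedSpan {S : Set (Vilenkin p → ℂ)} {f : Vilenkin p → ℂ} (hf : f ∈ S) {u : L₂ p}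
    (h : (u : Vilenkin p → ℂ) =ᵐ[haar p] f) : u ∈ closedSpan S :=
  Submodule.le_topologicalClosure _ (Submodule.subset_span ⟨f, hf, h⟩)

theorem classMem_closedSpan {S : Set (Vilenkin p → ℂ)} {f : Vilenkin p → ℂ} (hf : f ∈ S)
    (h : MemLp f 2 (haar p)) : ClassMem f (closedSpan S) :=
  ⟨h.toLp f, mem_closedSpan hf h.coeFn_toLp, h.coeFn_toLp⟩

theorem closedSpan_le {S : Set (Vilenkin p → ℂ)} {V : Submodule ℂ (L₂ p)}
    (hV : IsClosed (V : Set (L₂ p)))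
    (h : ∀ f ∈ S, ∀ u : L₂ p, (u : Vilenkin p → ℂ) =ᵐ[haar p] f → u ∈ V) : closedSpan S ≤ V :=
  Submodule.topologicalClosure_minimal _
    (Submodule.span_le.2 fun u ⟨f, hf, e⟩ => h f hf u e) hV

theorem memLp_comp {B : Vilenkin p → Vilenkin p} (hB : Measurable B) {c : ℝ≥0∞} (hc : c ≠ ∞)
    (h : (haar p).map B = c • haar p) {f : Vilenkin p → ℂ} (hf : MemLp f 2 (haar p)) :
    MemLp (f ∘ B) 2 (haar p) :=
  MemLp.comp_of_map (by rw [h]; exact hf.smul_measure hc) hB.aemeasurable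

theorem quasiMeasurePreserving_of_map_eq {B : Vilenkin p → Vilenkin p} (hB : Measurable B)
    {c : ℝ≥0∞} (h : (haar p).map B = c • haar p) :
    Measure.QuasiMeasurePreserving B (haar p) (haar p) :=
  ⟨hB, by rw [h]; exact Measure.smul_absolutelyContinuous⟩

/-- Composition with a map that multiplies the Haar measure by a constant is a bounded operator
on `L₂`. -/
theorem exists_compCLM {B : Vilenkin p → Vilenkin p} (hB : Measurable B) {c : ℝ≥0∞} (hc : c ≠ ∞)
    (h : (haar p).map B = c • haar p) : ∃ L : L₂ p →L[ℂ] L₂ p,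
      ∀ u : L₂ p, (L u : Vilenkin p → ℂ) =ᵐ[haar p] (u : Vilenkin p → ℂ) ∘ B := by
  have hq := quasiMeasurePreserving_of_map_eq hB h
  let L : L₂ p →ₗ[ℂ] L₂ p :=
    { toFun := fun u => (memLp_comp hB hc h (Lp.memLp u)).toLp _
      map_add' := fun u v => by
        refine Lp.ext ?_
        refine (MemLp.coeFn_toLp _).trans ?_
        refine (hq.ae_eq_comp (Lp.coeFn_add u v)).trans ?_
        refine .trans ?_ (Lp.coeFn_add _ _).symm
        exact ((MemLp.coeFn_toLp (memLp_comp hB hc h (Lp.memLp u))).add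
          (MemLp.coeFn_toLp (memLp_comp hB hc h (Lp.memLp v)))).symm
      map_smul' := fun z u => by
        refine Lp.ext ?_
        refine (MemLp.coeFn_toLp _).trans ?_
        refine (hq.ae_eq_comp (Lp.coeFn_smul z u)).trans ?_
        refine .trans ?_ (Lp.coeFn_smul _ _).symm
        exact ((MemLp.coeFn_toLp (memLp_comp hB hc h (Lp.memLp u))).const_smul z).symm }
  refine ⟨L.mkContinuous (c ^ (1 / (2 : ℝ≥0∞)).toReal).toReal fun u => ?_, fun u =>
    MemLp.coeFn_toLp (memLp_comp hB hc h (Lp.memLp u))⟩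
  have hu := Lp.aestronglyMeasurable u
  change ‖(memLp_comp hB hc h (Lp.memLp u)).toLp _‖ ≤ _
  rw [Lp.norm_toLp, Lp.norm_def, ← ENNReal.toReal_mul,
    ← eLpNorm_map_measure (by rw [h]; exact hu.smul_measure c) hB.aemeasurable, h,
    eLpNorm_smul_measure_of_ne_top (by simp), smul_eq_mul]

theorem ClassMem.comp {B : Vilenkin p → Vilenkin p} (hB : Measurable B) {c : ℝ≥0∞} (hc : c ≠ ∞)
    (h : (haar p).map B = c • haar p) {S S' : Set (Vilenkin p → ℂ)}
    (hS : ∀ f ∈ S, f ∘ B ∈ S') {f : Vilenkin p → ℂ} (hf : ClassMem f (closedSpan S)) :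
    ClassMem (f ∘ B) (closedSpan S') := by
  have hq := quasiMeasurePreserving_of_map_eq hB h
  obtain ⟨L, hL⟩ := exists_compCLM hB hc h
  have hle : closedSpan S ≤ (closedSpan S').comap (L : L₂ p →ₗ[ℂ] L₂ p) := by
    refine closedSpan_le ((isClosed_closedSpan S').preimage L.continuous) fun g hg u hu => ?_
    exact mem_closedSpan (hS g hg) ((hL u).trans (hq.ae_eq_comp hu))
  obtain ⟨u, hu, e⟩ := hf
  exact ⟨L u, hle hu, (hL u).trans (hq.ae_eq_comp e)⟩

/-! ### The scale of spaces generated by a function -/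

theorem map_sub_right_haar (h : Vilenkin p) :
    (haar p).map (fun x => x - h) = (1 : ℝ≥0∞) • haar p := by
  rw [one_smul]
  exact (measurePreserving_sub_right (haar p) h).map_eq

theorem memLp_comp_sub {f : Vilenkin p → ℂ} (hf : MemLp f 2 (haar p)) (h : Vilenkin p) :
    MemLp (fun x => f (x - h)) 2 (haar p) :=
  hf.comp_measurePreserving (measurePreserving_sub_right (haar p) h)

theorem memLp_comp_dilationPow {f : Vilenkin p → ℂ} (hf : MemLp f 2 (haar p)) (n : ℤ) :
    MemLp (fun x => f (dilationPow p n x)) 2 (haar p) := by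
  induction n with
  | zero => simpa only [dilationPow_zero] using hf
  | succ n ih =>
    have := memLp_comp continuous_dilation.measurable (by simp [NeZero.ne p]) map_dilation_haar ih
    simpa only [Function.comp_def, ← dilationPow_add_one] using this
  | pred n ih =>
    have := memLp_comp continuous_dilation_symm.measurable (by simp) map_dilation_symm_haar ih
    have e (x : Vilenkin p) :
        dilationPow p (-(n : ℤ)) ((dilation p).symm x) = dilationPow p (-(n : ℤ) - 1) x := by
      have h1 := dilationPow_add_one (-(n : ℤ) - 1) ((dilation p).symm x)
      rwa [sub_add_cancel, AddEquiv.apply_symm_apply] at h1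
    simpa only [Function.comp_def, e] using this

/-- The functions `φ(A^n x - h)` with `h ∈ H_0`. -/
def scaleSystem (φ : Vilenkin p → ℂ) (n : ℤ) : Set (Vilenkin p → ℂ) :=
  {f | ∃ h ∈ H₀ p, f = fun x => φ (dilationPow p n x - h)}

theorem scaleSpace_eq (φ : Vilenkin p → ℂ) (n : ℤ) :
    scaleSpace φ n = closedSpan (scaleSystem φ n) := by
  unfold scaleSpace closedSpan scaleSystem
  congr 2
  ext u
  constructor
  · rintro ⟨h, hh, e⟩
    exact ⟨_, ⟨h, hh, rfl⟩, e⟩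
  · rintro ⟨_, ⟨h, hh, rfl⟩, e⟩
    exact ⟨h, hh, e⟩

theorem classMem_scaleSpace_dilation_iff (φ : Vilenkin p → ℂ) (n : ℤ) (f : Vilenkin p → ℂ) :
    ClassMem f (scaleSpace φ n) ↔ ClassMem (fun x => f (dilation p x)) (scaleSpace φ (n + 1)) := by
  rw [scaleSpace_eq, scaleSpace_eq]
  constructor
  · refine ClassMem.comp continuous_dilation.measurable (by simp [NeZero.ne p]) map_dilation_haar ?_
    rintro _ ⟨h, hh, rfl⟩
    exact ⟨h, hh, funext fun x => by simp only [Function.comp_apply, dilationPow_add_one]⟩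
  · intro hf
    have := ClassMem.comp (S' := scaleSystem φ n) continuous_dilation_symm.measurable (by simp)
      map_dilation_symm_haar (by
        rintro _ ⟨h, hh, rfl⟩
        exact ⟨h, hh, funext fun x => by
          simp only [Function.comp_apply, dilationPow_add_one, AddEquiv.apply_symm_apply]⟩) hf
    simpa only [Function.comp_def, AddEquiv.apply_symm_apply] using this

omit [NeZero p] in
theorem add_mem_H₀ {h h' : Vilenkin p} (hh : h ∈ H₀ p) (hh' : h' ∈ H₀ p) : h + h' ∈ H₀ p :=
  fun k hk => by rw [add_apply, hh k hk, hh' k hk, add_zero]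

omit [NeZero p] in
theorem sub_mem_H₀ {h h' : Vilenkin p} (hh : h ∈ H₀ p) (hh' : h' ∈ H₀ p) : h - h' ∈ H₀ p :=
  fun k hk => by rw [sub_apply, hh k hk, hh' k hk, sub_zero]

theorem classMem_scaleSpace_shift (φ : Vilenkin p → ℂ) {f : Vilenkin p → ℂ}
    (hf : ClassMem f (scaleSpace φ 0)) {h : Vilenkin p} (hh : h ∈ H₀ p) :
    ClassMem (fun x => f (x - h)) (scaleSpace φ 0) := by
  rw [scaleSpace_eq] at hf ⊢
  refine ClassMem.comp (continuous_sub_right h).measurable (by simp) (map_sub_right_haar h) ?_ hf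
  rintro _ ⟨h', hh', rfl⟩
  refine ⟨h + h', add_mem_H₀ hh hh', funext fun x => ?_⟩
  simp only [Function.comp_apply, dilationPow_zero, sub_sub]

theorem scaleSpace_congr_ae {φ ψ : Vilenkin p → ℂ} (h : φ =ᵐ[haar p] ψ) :
    scaleSpace φ = scaleSpace ψ := by
  funext n
  unfold scaleSpace
  congr 2
  ext u
  refine exists_congr fun g => and_congr_right fun _ => ?_
  have hq : Measure.QuasiMeasurePreserving (fun x => dilationPow p n x - g) (haar p) (haar p) :=
    (measurePreserving_sub_right (haar p) g).quasiMeasurePreserving.comp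
      (quasiMeasurePreserving_dilationPow n)
  have := hq.ae_eq_comp h
  exact ⟨fun e => e.trans this, fun e => e.trans this.symm⟩

theorem generatesMRA_congr_ae {φ ψ : Vilenkin p → ℂ} (h : φ =ᵐ[haar p] ψ)
    (hφ : GeneratesMRA φ) : GeneratesMRA ψ := by
  obtain ⟨h1, ⟨e, he, ho, hs⟩, h3⟩ := hφ
  rw [scaleSpace_congr_ae h] at hs h3
  refine ⟨(memLp_congr_ae h).1 h1, ⟨e, fun g => (he g).trans ?_, ho, hs⟩, h3⟩
  exact (measurePreserving_sub_right (haar p) g.1).quasiMeasurePreserving.ae_eq_comp h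

/-- Orthonormal shifts form a basis of `V_0`. -/
theorem isScalingFunction_scaleSpace {φ : Vilenkin p → ℂ} (hφ : MemLp φ 2 (haar p))
    (ho : ∀ h ∈ H₀ p, ∫ x, φ (x - h) * conj (φ x) ∂(haar p) =
      open Classical in if h = 0 then 1 else 0) :
    IsScalingFunction (scaleSpace φ 0) φ := by
  classical
  refine ⟨fun h => (memLp_comp_sub hφ h.1).toLp _, fun h => MemLp.coeFn_toLp _, ?_, ?_⟩
  · rw [orthonormal_iff_ite]
    intro g h
    rw [L2.inner_def]
    have e : ∫ x, inner ℂ ((memLp_comp_sub hφ g.1).toLp _ x) ((memLp_comp_sub hφ h.1).toLp _ x)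
        ∂(haar p) = ∫ x, φ (x - h.1) * conj (φ (x - g.1)) ∂(haar p) := by
      refine integral_congr_ae ?_
      filter_upwards [(memLp_comp_sub hφ g.1).coeFn_toLp, (memLp_comp_sub hφ h.1).coeFn_toLp]
        with x h1 h2
      rw [h1, h2, RCLike.inner_apply]
    rw [e, ← integral_add_right_eq_self _ g.1]
    have := ho (h.1 - g.1) (sub_mem_H₀ h.2 g.2)
    simp only [sub_eq_zero, ← sub_add, sub_add_eq_add_sub] at this
    simp only [add_sub_cancel_right]
    rw [this]
    simp only [Subtype.ext_iff, eq_comm]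
  · unfold scaleSpace
    congr 2
    ext u
    simp only [dilationPow_zero, Set.mem_range, Subtype.exists]
    refine exists_congr fun h => ?_
    constructor
    · rintro ⟨hh, rfl⟩
      exact ⟨hh, MemLp.coeFn_toLp _⟩
    · rintro ⟨hh, e⟩
      exact ⟨hh, Lp.ext ((MemLp.coeFn_toLp _).trans e.symm)⟩

/-- An element of `L₂` whose integrals over all cosets vanish is zero. -/
theorem eq_zero_of_inner_coset {u : L₂ p}
    (h : ∀ n g, inner ℂ (indicatorConstLp 2 (measurableSet_coset n g) (haar_coset_ne_top n g) (1 : ℂ))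
      u = 0) : u = 0 := by
  refine (Lp.eq_zero_iff_ae_eq_zero).2 (ae_eq_zero_of_forall_setIntegral_coset (fun n g => ?_)
    fun n g => ?_)
  · exact integrableOn_Lp_of_measure_ne_top u (by norm_num) (haar_coset_ne_top n g)
  · rw [← L2.inner_indicatorConstLp_one (measurableSet_coset n g) (haar_coset_ne_top n g), h]

/-! ### The multiresolution analysis -/

section Nilpotent

variable {π : ZMod p → ZMod p} {D : ℕ}

/-- The functions `(1_{G_{-1} + h} χ_a)(A^n x)`. -/
def atomSystem (π : ZMod p → ZMod p) (D : ℕ) (n : ℤ) : Set (Vilenkin p → ℂ) :=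
  {f | ∃ h a, f = fun x => atom π D h a (dilationPow p n x)}

theorem classMem_atom (h : Vilenkin p) (a : ZMod p) (n : ℤ) :
    ClassMem (fun x => atom π D h a (dilationPow p n x)) (closedSpan (atomSystem π D n)) :=
  classMem_closedSpan ⟨h, a, rfl⟩ (memLp_comp_dilationPow (memLp_atom h a 2) n)

theorem scaleSpace_scalingFun (h0 : π 0 = 0) (hD : ∀ a, π^[D] a = 0) {c : ZMod p → ℂ}
    (hc : ∀ a, ‖c a‖ = 1) (n : ℤ) :
    scaleSpace (scalingFun π D c) n = closedSpan (atomSystem π D n) := by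
  rw [scaleSpace_eq]
  refine le_antisymm (closedSpan_le (isClosed_closedSpan _) ?_)
    (closedSpan_le (isClosed_closedSpan _) ?_)
  · rintro _ ⟨h, hh, rfl⟩ u hu
    simp only [scalingFun_sub] at hu
    exact (ClassMem.sum _ _ fun a _ => classMem_atom h a n).mem hu
  · rintro _ ⟨g, a, rfl⟩ u hu
    obtain ⟨z, h, hh, e⟩ := exists_atom_eq_sum h0 hD hc g a
    simp only [e] at hu
    have hm (t : ZMod p) : ClassMem (fun x => scalingFun π D c (dilationPow p n x - h t))
        (closedSpan (scaleSystem (scalingFun π D c) n)) :=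
      classMem_closedSpan ⟨h t, hh t, rfl⟩
        (memLp_comp_dilationPow (memLp_comp_sub (memLp_scalingFun c 2) (h t)) n)
    exact (ClassMem.sum _ _ fun t _ => hm t).mem hu

theorem closedSpan_atomSystem_mono (hD : ∀ a, π^[D] a = 0) (n : ℤ) :
    closedSpan (atomSystem π D n) ≤ closedSpan (atomSystem π D (n + 1)) := by
  refine closedSpan_le (isClosed_closedSpan _) ?_
  rintro _ ⟨h, a, rfl⟩ u hu
  have e (x : Vilenkin p) : dilation p (dilationPow p n x) = dilationPow p (n + 1) x := by
    ext k
    rw [dilation_apply, dilationPow_apply, dilationPow_apply]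
    ring_nf
  simp only [atom_eq_sum_dilation hD h a, e] at hu
  exact (ClassMem.sum _ _ fun t _ => classMem_atom _ _ _).mem hu

/-- The indicators of the cosets of `G_n` belong to `V_{n+1}`: they are dilations of the functions
`1_{G_{-1} + h} χ_0`. -/
theorem indicator_mem_closedSpan (h0 : π 0 = 0) (n : ℤ) (g : Vilenkin p) :
    indicatorConstLp 2 (measurableSet_coset n g) (haar_coset_ne_top n g) (1 : ℂ) ∈
      closedSpan (atomSystem π D (n + 1)) := by
  classical
  refine (classMem_atom (dilationPow p (n + 1) g) 0 (n + 1)).mem ?_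
  refine indicatorConstLp_coeFn.trans (.of_forall fun x => ?_)
  have : dilationPow p (n + 1) x ∈ coset (-1) (dilationPow p (n + 1) g) ↔ x ∈ coset n g := by
    rw [dilationPow_mem_coset, neg_add_cancel_comm_assoc]
  dsimp only
  rw [atom_eq_ite π D 0 this, pathChar_zero_apply h0, Set.indicator_apply]

theorem monotone_closedSpan_atomSystem (hD : ∀ a, π^[D] a = 0) :
    Monotone fun n => closedSpan (atomSystem π D n) :=
  monotone_int_of_le_succ (closedSpan_atomSystem_mono hD)

theorem closure_iUnion_atomSystem (h0 : π 0 = 0) (hD : ∀ a, π^[D] a = 0) :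
    closure (⋃ n, (closedSpan (atomSystem π D n) : Set (L₂ p))) = Set.univ := by
  rw [← Submodule.coe_iSup_of_directed _ (monotone_closedSpan_atomSystem hD).directed_le,
    ← Submodule.topologicalClosure_coe, ← Submodule.top_coe (R := ℂ), SetLike.coe_set_eq,
    Submodule.topologicalClosure_eq_top_iff, Submodule.eq_bot_iff]
  intro u hu
  refine eq_zero_of_inner_coset fun n g => ?_
  exact hu _ (Submodule.mem_iSup_of_mem (n + 1) (indicator_mem_closedSpan h0 n g))

/-- For an element of `V_n` and a coset contained in a coset `C` of `G_{n+D-1}`, the mean value over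
the smaller coset equals the mean value over `C`. -/
theorem inner_coset_of_mem_closedSpan {n m : ℤ} (hnm : n + D - 1 ≤ m) (g : Vilenkin p) {u : L₂ p}
    (hu : u ∈ closedSpan (atomSystem π D n)) :
    inner ℂ (indicatorConstLp 2 (measurableSet_coset m g) (haar_coset_ne_top m g) (1 : ℂ)) u =
      (p : ℂ) ^ (n + D - 1 - m) * inner ℂ (indicatorConstLp 2 (measurableSet_coset (n + D - 1) g)
        (haar_coset_ne_top (n + D - 1) g) (1 : ℂ)) u := by
  set r := n + D - 1 with hr
  set w := indicatorConstLp 2 (measurableSet_coset m g) (haar_coset_ne_top m g) (1 : ℂ)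
  set v := indicatorConstLp 2 (measurableSet_coset r g) (haar_coset_ne_top r g) (1 : ℂ)
  have hp : (p : ℂ) ≠ 0 := NeZero.ne _
  let K : Submodule ℂ (L₂ p) :=
    LinearMap.ker (innerSL ℂ w - (p : ℂ) ^ (r - m) • innerSL ℂ v : L₂ p →L[ℂ] ℂ).toLinearMap
  have hK : IsClosed (K : Set (L₂ p)) := ContinuousLinearMap.isClosed_ker _
  suffices closedSpan (atomSystem π D n) ≤ K by
    have := this hu
    simpa [K, sub_eq_zero] using this
  refine closedSpan_le hK ?_
  rintro _ ⟨h, a, rfl⟩ f hf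
  have hconst : ∀ x ∈ coset r g, atom π D h a (dilationPow p n x) =
      atom π D h a (dilationPow p n g) := fun x hx => by
    refine atom_eq_of_mem_coset h a (dilationPow_mem_coset.2 ?_)
    rwa [show (D : ℤ) - 1 + n = r by rw [hr]; ring]
  have key (s : ℤ) (hs : r ≤ s) : inner ℂ (indicatorConstLp 2 (measurableSet_coset s g)
      (haar_coset_ne_top s g) (1 : ℂ)) f = (p : ℂ) ^ (-s) * atom π D h a (dilationPow p n g) := by
    rw [L2.inner_indicatorConstLp_one, setIntegral_congr_ae (measurableSet_coset s g)
      (hf.mono fun x hx hxs => hx.trans (hconst x (coset_subset hs g hxs))), setIntegral_const,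
      haar_real_coset, Complex.real_smul]
    push_cast
    rfl
  have : inner ℂ w f - (p : ℂ) ^ (r - m) * inner ℂ v f = 0 := by
    rw [key m hnm, key r le_rfl, ← mul_assoc, ← zpow_add₀ hp, sub_eq_zero]
    congr 2
    ring
  simpa [K] using this

theorem iInf_closedSpan_atomSystem (hp : 1 < p) : ⨅ n, closedSpan (atomSystem π D n) = ⊥ := by
  rw [Submodule.eq_bot_iff]
  intro u hu
  rw [Submodule.mem_iInf] at hu
  refine eq_zero_of_inner_coset fun m g => ?_
  set w := indicatorConstLp 2 (measurableSet_coset m g) (haar_coset_ne_top m g) (1 : ℂ)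
  have hp0 : (0 : ℝ) < p := by exact_mod_cast (zero_lt_one.trans hp)
  -- Averaging over cosets of `G_{m-j}` and the Cauchy-Schwarz inequality.
  have hb (j : ℕ) : ‖inner ℂ w u‖ ^ 2 ≤ ((p : ℝ)⁻¹) ^ j * (p : ℝ) ^ (-m) * ‖u‖ ^ 2 := by
    have h1 := inner_coset_of_mem_closedSpan (n := m - j - D + 1) (m := m) (by lia) g (hu _)
    simp only [show m - (j : ℤ) - D + 1 + D - 1 = m - j by ring,
      show m - (j : ℤ) - m = -j by ring] at h1
    set v := indicatorConstLp 2 (measurableSet_coset (m - j) g) (haar_coset_ne_top (m - j) g) (1 : ℂ)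
      with hv
    have hvn : ‖v‖ ^ 2 = (p : ℝ) ^ (-(m - j)) := by
      rw [hv, ← haar_real_coset (m - (j : ℤ)) g, norm_indicatorConstLp (by simp) (by simp)]
      simp only [norm_one, one_mul, ENNReal.toReal_ofNat]
      rw [← Real.rpow_natCast, ← Real.rpow_mul measureReal_nonneg]
      norm_num
    change inner ℂ w u = _ at h1
    have hcs : ‖inner ℂ v u‖ ≤ ‖v‖ * ‖u‖ := norm_inner_le_norm v u
    calc ‖inner ℂ w u‖ ^ 2 = ((p : ℝ) ^ (-(j : ℤ))) ^ 2 * ‖inner ℂ v u‖ ^ 2 := by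
          rw [h1, norm_mul, mul_pow, norm_zpow, Complex.norm_natCast]
      _ ≤ ((p : ℝ) ^ (-(j : ℤ))) ^ 2 * (‖v‖ * ‖u‖) ^ 2 := by gcongr
      _ = ((p : ℝ)⁻¹) ^ j * (p : ℝ) ^ (-m) * ‖u‖ ^ 2 := by
          rw [mul_pow, hvn, show -(m - (j : ℤ)) = j + -m by ring, zpow_add₀ hp0.ne', zpow_neg,
            zpow_natCast]
          simp only [inv_pow]
          have : (p : ℝ) ^ j ≠ 0 := pow_ne_zero _ hp0.ne'
          field_simp
  have ht : Tendsto (fun j : ℕ => ((p : ℝ)⁻¹) ^ j * (p : ℝ) ^ (-m) * ‖u‖ ^ 2) atTop (𝓝 0) := by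
    have := (tendsto_pow_atTop_nhds_zero_of_lt_one (inv_nonneg.2 hp0.le)
      (inv_lt_one_of_one_lt₀ (by exact_mod_cast hp : (1 : ℝ) < p))).mul_const
        ((p : ℝ) ^ (-m) * ‖u‖ ^ 2)
    simpa only [zero_mul, mul_assoc] using this
  have := ge_of_tendsto' ht hb
  exact norm_eq_zero.1 (pow_eq_zero_iff two_ne_zero |>.1 (le_antisymm this (sq_nonneg _)))

theorem generatesMRA_scalingFun (hp : 1 < p) (h0 : π 0 = 0) (hD : ∀ a, π^[D] a = 0)
    {c : ZMod p → ℂ} (hc : ∀ a, ‖c a‖ = 1) : GeneratesMRA (scalingFun π D c) := by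
  have hL : MemLp (scalingFun π D c) 2 (haar p) := memLp_scalingFun c 2
  have hS : IsScalingFunction (scaleSpace (scalingFun π D c) 0) (scalingFun π D c) :=
    isScalingFunction_scaleSpace hL fun h hh => integral_scalingFun_shift h0 hD hc hh
  have e : scaleSpace (scalingFun π D c) = fun n => closedSpan (atomSystem π D n) :=
    funext (scaleSpace_scalingFun h0 hD hc)
  refine ⟨hL, hS, ?_, ?_, ?_, ?_, classMem_scaleSpace_dilation_iff _, fun f hf h hh =>
    classMem_scaleSpace_shift _ hf hh, ⟨_, hL, hS⟩⟩
  · exact fun n => Submodule.isClosed_topologicalClosure _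
  · rw [e]
    exact closedSpan_atomSystem_mono hD
  · rw [e]
    exact closure_iUnion_atomSystem h0 hD
  · rw [e]
    exact iInf_closedSpan_atomSystem hp

end Nilpotent

/-- Every mask generated by a tree has a scaling function of the form `scalingFun`. -/
theorem GeneratesMask.exists_hasMask_scalingFun {T : SimpleGraph (Fin p)} (hT : T.IsTree)
    {m₀ : dual p → ℂ} (hm : GeneratesMask T m₀) :
    ∃ (D : ℕ) (c : ZMod p → ℂ), (∀ a, (parent T)^[D] a = 0) ∧ (∀ a, ‖c a‖ = 1) ∧
      HasMask m₀ (scalingFun (parent T) D c) := by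
  obtain ⟨l, hl, hl0, hml⟩ := hm.exists_eq hT
  obtain ⟨D, hD⟩ := exists_iterate_parent_eq_zero hT
  refine ⟨D, fun a => ∏ k ∈ Finset.range D, l ((parent T)^[k] a), hD, fun a => by simp [hl],
    memLp_one_iff_integrable.1 (memLp_scalingFun _ 1), memLp_scalingFun _ 2, ?_⟩
  refine hasProd_fourier_scalingFun (parent_zero T) hD hl0 (fun χ hχ => ?_) fun χ hχ => ?_
  · rw [hml, if_pos hχ]
  · rw [hml, if_neg hχ]

/-- The infinite product determines the Fourier transform, hence the function. -/
theorem HasMask.ae_eq {m₀ : dual p → ℂ} {φ ψ : Vilenkin p → ℂ} (hφ : HasMask m₀ φ)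
    (hψ : HasMask m₀ ψ) : φ =ᵐ[haar p] ψ := by
  have hz : φ - ψ =ᵐ[haar p] 0 := by
    refine ae_eq_zero_of_fourier_eq_zero (hφ.integrable.sub hψ.integrable) fun χ => ?_
    have := (hφ.hasProd χ).unique (hψ.hasProd χ)
    unfold fourier at this ⊢
    simp only [Pi.sub_apply, sub_mul]
    rw [integral_sub (integrable_mul_conj_dual hφ.integrable χ)
      (integrable_mul_conj_dual hψ.integrable χ), this, sub_self]
  filter_upwards [hz] with x hx
  exact sub_eq_zero.1 hx

end NeZero

end Vilenkin

theorem theorem4p2 (p : ℕ) [Fact p.Prime] (hp : 3 ≤ p) (T : SimpleGraph (Fin p))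
    (hT : T.IsTree) :
    (∃ m₀ : Vilenkin.dual p → ℂ, Vilenkin.GeneratesMask T m₀) ∧
      ∀ m₀ : Vilenkin.dual p → ℂ, Vilenkin.GeneratesMask T m₀ →
        (∃ φ : Vilenkin p → ℂ, Vilenkin.IsStepFunction φ ∧ Vilenkin.HasMask m₀ φ) ∧
          ∀ φ : Vilenkin p → ℂ, Vilenkin.HasMask m₀ φ → Vilenkin.GeneratesMRA φ := by
  refine ⟨Vilenkin.exists_generatesMask hT, fun m₀ hm => ?_⟩
  obtain ⟨D, c, hD, hc, h⟩ := hm.exists_hasMask_scalingFun hT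
  exact ⟨⟨_, Vilenkin.isStepFunction_scalingFun c, h⟩, fun φ hφ =>
    Vilenkin.generatesMRA_congr_ae (h.ae_eq hφ)
      (Vilenkin.generatesMRA_scalingFun (by lia) (Vilenkin.parent_zero T) hD hc)⟩
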